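/- **Theorem (Average minimum transmit power for norm-based user selection).** Let $M\ge 1$, $0\le K_s\le \min(M,K)$, $\sigma>0$, and let $\mathbf h_1,\dots,\mathbf h_K\in\mathbb C^M$ be random channel vectors whose $KM$ entries are i.i.d. circularly symmetric complex Gaussian with mean $0$ and variance $1$. Norm-based user selection (NUS) sorts the $K$ users by decreasing channel norm and selects the first $K_s$. Write $\mathbf g_1,\dots,\mathbf g_{K_s}$ for the selected channels ordered from weakest to strongest, so $\|\mathbf g_i\|$ is the $(K_s+1-i)$-th largest of $\|\mathbf h_1\|,\dots,\|\mathbf h_K\|$. Let $\theta_{i-1}$ be the angle between $\mathbf g_i$ and $\mathrm{span}(\mathbf g_1,\dots,\mathbf g_{i-1})$, with $\theta_0=\pi/2$. For a common SINR target $\gamma>0$ let $p^{\mathrm{DL}}(\gamma)$ be the minimum of $\sum_k p_k$ over unit-norm beamformers $\mathbf v_k\in\mathbb C^M$ and powers $p_k>0$ subject to $$\frac{p_k|\mathbf g_k^\dagger\mathbf v_k|^2}{\sum_{j>k}p_j|\mathbf g_k^\dagger\mathbf v_j|^2+\sigma^2}\ge\gamma\qquad(1\le k\le K_s)$$ (downlink,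 dirty paper coding, weakest user encoded first), and $p^{\mathrm{UL}}(\gamma)$ the minimum of $\sum_k p_k$ subject to $$\frac{p_k|\mathbf g_k^\dagger\mathbf v_k|^2}{\sum_{j<k}p_j|\mathbf g_j^\dagger\mathbf v_k|^2+\sigma^2}\ge\gamma\qquad(1\le k\le K_s)$$ (dual uplink, successive interference cancellation, weaker users decoded with less interference). Their high-SINR expression is $$p_{\mathrm{tx}}(\gamma)=\sigma^2\sum_{i=1}^{K_s}\frac{\gamma}{\|\mathbf g_i\|^2\sin^2\theta_{i-1}} .$$ Let $F_{\|\mathbf h\|^2}(M,r,K;\cdot)$ be the distribution function of the $r$-th largest squared norm among $K$ independent standard complex Gaussian vectors in $\mathbb C^M$, let $F_{\sin^2\theta_j}(M;\cdot)$ be that of $\sin^2$ of the angle between such a vector and the span of $j$ further independent ones, and put $$S=\sum_{i=1}^{K_s}\mathbb E_{F_{\|\mathbf h\|^2}(M,K_s+1-i,K;x)}\!\left[\tfrac1x\right]\,\mathbb E_{F_{\sin^2\theta_{i-1}}(M;x)}\!\left[\tfrac1x\right].$$ Then, with expectations taken in $[0,\infty]$: 1. $\mathbb E[p_{\mathrm{tx}}(\gamma)]=\sigma^2\gamma\,S$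 for every $\gamma>0$. 2. $\mathbb E[p^{\mathrm{DL}}(\gamma)]/\gamma\to\sigma^2S$ and $\mathbb E[p^{\mathrm{UL}}(\gamma)]/\gamma\to\sigma^2S$ as $\gamma\to\infty$. 3. $S<\infty$ if $K_s<M$. 4. Among all orderings of the selected users by norm rank, i.e. replacing $(\mathbf g_i)_i$ by $(\mathbf g_{\tau(i)})_i$ for a fixed permutation $\tau$ in the definition of $p_{\mathrm{tx}}$, the ordering from weakest to strongest gives the smallest $\mathbb E[p_{\mathrm{tx}}(\gamma)]$. 5. For $1\le r\le K$, $F_{\|\mathbf h\|^2}(M,r,K;x)=\sum_{j=K+1-r}^{K}\binom Kj G(x)^j(1-G(x))^{K-j}$, where $G$ is the distribution function of the Gamma law with shape $M$ and rate $1$. For $1\le j<M$ the law of $\sin^2\theta_j$ is $\mathrm{Beta}(M-j,j)$ (so that of $\sin^2\theta_{i-1}$ is $\mathrm{Beta}(M-i+1,i-1)$ for $2\le i\le M$), and $\sin^2\theta_0=1$. -/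

import Mathlib

open MeasureTheory ProbabilityTheory Filter Topology
open scoped ENNReal

noncomputable section

/-- The circularly symmetric complex Gaussian law with mean zero and unit variance: real and
imaginary parts are independent real Gaussians of mean `0` and variance `1 / 2`. -/
def stdComplexGaussian : Measure ℂ :=
  ((gaussianReal 0 (1 / 2)).prod (gaussianReal 0 (1 / 2))).map fun p => (⟨p.1, p.2⟩ : ℂ)

/-- The law of a vector in `ℂ ^ M` with i.i.d. standard complex Gaussian entries. -/
def complexGaussianVec (M : ℕ) : Measure (EuclideanSpace ℂ (Fin M)) :=
  (Measure.pi fun _ : Fin M => stdComplexGaussian).map (WithLp.toLp 2)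

/-- A permutation listing the indices in descending order of the values of `x`. -/
def descendingOrder {K : ℕ} (x : Fin K → ℝ) : Equiv.Perm (Fin K) :=
  Tuple.sort fun k => OrderDual.toDual (x k)

/-- Norm-based user selection. All users are sorted in descending order of channel norm and the
first `Ks` are selected. The selected channels are listed from the weakest (index `0`) to the
strongest (index `Ks - 1`): index `i` holds the user with the `(Ks - i)`-th largest norm. -/
def nusChannels {M K Ks : ℕ} (hK : Ks ≤ K) (h : Fin K → EuclideanSpace ℂ (Fin M)) :
    Fin Ks → EuclideanSpace ℂ (Fin M) :=
  fun i => h (descendingOrder (fun k => ‖h k‖) (Fin.castLE hK i.rev))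

/-- The angle between a vector and a subspace; it is `π / 2` for the zero subspace. -/
def subspaceAngle {M : ℕ} (v : EuclideanSpace ℂ (Fin M))
    (S : Submodule ℂ (EuclideanSpace ℂ (Fin M))) : ℝ :=
  Real.arccos (‖S.starProjection v‖ / ‖v‖)

/-- The interference subspace of the `i`-th vector: the span of the vectors preceding it. -/
def interferenceSpan {M n : ℕ} (g : Fin n → EuclideanSpace ℂ (Fin M)) (i : Fin n) :
    Submodule ℂ (EuclideanSpace ℂ (Fin M)) :=
  Submodule.span ℂ (g '' {j | j < i})

/-- `sin² θ`, with `θ` the angle between `g i` and its interference subspace. -/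
def sinSqAngle {M n : ℕ} (g : Fin n → EuclideanSpace ℂ (Fin M)) (i : Fin n) : ℝ :=
  Real.sin (subspaceAngle (g i) (interferenceSpan g i)) ^ 2

/-- The high-SINR expression `σ² ∑ i, γ / (‖g i‖² sin² θ i)` of the instantaneous minimum
transmit power; it is infinite if some denominator vanishes. -/
def highSINRPower {M n : ℕ} (σ γ : ℝ) (g : Fin n → EuclideanSpace ℂ (Fin M)) : ℝ≥0∞ :=
  ∑ i, ENNReal.ofReal (σ ^ 2 * γ) / ENNReal.ofReal (‖g i‖ ^ 2 * sinSqAngle g i)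

/-- SINR of user `k` in the downlink with dirty paper coding, where the users are encoded in the
order `0, 1, 2, …`: user `k` is only disturbed by the streams encoded after its own. Here `v j`
is the beamformer and `p j` the power of stream `j`. -/
def downlinkSINR {M n : ℕ} (σ : ℝ) (g v : Fin n → EuclideanSpace ℂ (Fin M)) (p : Fin n → ℝ)
    (k : Fin n) : ℝ :=
  p k * ‖inner ℂ (g k) (v k)‖ ^ 2 /
    (∑ j with k < j, p j * ‖inner ℂ (g k) (v j)‖ ^ 2 + σ ^ 2)

/-- SINR of user `k` in the uplink with successive interference cancellation, where the users are
decoded in the order `n - 1, …, 1, 0`: user `k` is decoded while the streams `j < k` still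
interfere. Here `v k` is the receive beamformer and `p k` the power of user `k`. -/
def uplinkSINR {M n : ℕ} (σ : ℝ) (g v : Fin n → EuclideanSpace ℂ (Fin M)) (p : Fin n → ℝ)
    (k : Fin n) : ℝ :=
  p k * ‖inner ℂ (g k) (v k)‖ ^ 2 /
    (∑ j with j < k, p j * ‖inner ℂ (g j) (v k)‖ ^ 2 + σ ^ 2)

/-- The least total power, over unit-norm beamformers and positive powers, for which every SINR
is at least `γ`. It is infinite if the targets cannot be met. -/
def minPower {M n : ℕ}
    (sinr : (Fin n → EuclideanSpace ℂ (Fin M)) → (Fin n → ℝ) → Fin n → ℝ) (γ : ℝ) : ℝ≥0∞ :=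
  ⨅ (v : Fin n → EuclideanSpace ℂ (Fin M)) (p : Fin n → ℝ)
    (_ : (∀ i, ‖v i‖ = 1) ∧ (∀ i, 0 < p i) ∧ ∀ i, γ ≤ sinr v p i),
      ENNReal.ofReal (∑ i, p i)

/-- The law of the `(r + 1)`-th largest squared norm among `K` independent standard complex
Gaussian vectors in `ℂ ^ M` (so `r = 0` is the largest one). -/
def normOrderStatLaw (M K : ℕ) (r : Fin K) : Measure ℝ :=
  (Measure.pi fun _ : Fin K => complexGaussianVec M).map fun h =>
    (fun k => ‖h k‖ ^ 2) (descendingOrder (fun k => ‖h k‖ ^ 2) r)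

/-- The law of `sin² θ`, with `θ` the angle between a standard complex Gaussian vector in `ℂ ^ M`
and the span of `j` further independent ones. -/
def sinSqAngleLaw (M j : ℕ) : Measure ℝ :=
  (Measure.pi fun _ : Fin (j + 1) => complexGaussianVec M).map fun h =>
    sinSqAngle h (Fin.last j)

/-- The expectation of `1 / x` under a law on the nonnegative reals, as an element of `[0, ∞]`. -/
def expInv (ν : Measure ℝ) : ℝ≥0∞ :=
  ∫⁻ x, (ENNReal.ofReal x)⁻¹ ∂ν

/-- `∑ i, E[1 / x] E[1 / x]` for `i = 1, …, Ks`, the first factor under the law of the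
`(Ks + 1 - i)`-th largest squared norm and the second one under the law of `sin²` of the angle
with an `(i - 1)`-dimensional subspace (in the code `i` starts at `0`). -/
def nusSum (M : ℕ) {K Ks : ℕ} (hK : Ks ≤ K) : ℝ≥0∞ :=
  ∑ i : Fin Ks,
    expInv (normOrderStatLaw M K (Fin.castLE hK i.rev)) * expInv (sinSqAngleLaw M i)

end

/-! ### Gamma–Beta algebra for sums and ratios of Gamma variables. -/

section

/-! The averages factor because norms and angles decouple. Unitary invariance lets a Gaussian vector
be read in an orthonormal basis adapted to a fixed subspace. Its squared lengths inside and outside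
the subspace are then independent Gamma variables, so their sum (the squared norm) and the outside
fraction (`sin²`) are independent, with Gamma and Beta laws (`map_norm_sq_sin_sq`). Sorting looks at
norms only. On the event that fixes the sorting permutation, the ranks are fixed users, and one
user's vector can be integrated out with the others frozen: everything but its angle depends on it
through its norm, so each summand splits (`lintegral_mul_sin_sq`, `lintegral_inv_nusChannels`).

The exact minimum powers are squeezed pointwise. Zero forcing is feasible for both links and costs
exactly the high-SINR expression. From below, gains `q k` that control each channel against its
interference force total power at least `γσ² ∑ 1 / q k`, by induction in the uplink and by weak
duality in the downlink. The choice `regularizedGain` is antitone in `γ` and exceeds `‖g k‖² sin²`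
by at most `O(1 / γ)`, so monotone convergence gives the limit even when `S = ∞`.

For the ordering, `E[1 / ‖g i‖²]` decreases and `E[1 / sin²]` increases with position, and the
rearrangement inequality says that oppositely sorted pairings have the least sum. -/

lemma lintegral_comp_mul_left_of_pos {s : ℝ} (hs : 0 < s) (f : ℝ → ℝ≥0∞) :
    ∫⁻ y, f y = ENNReal.ofReal s * ∫⁻ t, f (s * t) := by
  have h := Real.smul_map_volume_mul_left hs.ne'
  conv_lhs => rw [← h]
  have h2 := (Homeomorph.mulLeft₀ s hs.ne').measurableEmbedding.lintegral_map (μ := volume) f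
  rw [Homeomorph.coe_mulLeft₀] at h2
  rw [lintegral_smul_measure, h2, abs_of_pos hs, smul_eq_mul]

lemma measurable_gammaPDF (a r : ℝ) : Measurable (gammaPDF a r) :=
  (measurable_gammaPDFReal a r).ennreal_ofReal

lemma measurable_betaPDF (a b : ℝ) : Measurable (betaPDF a b) :=
  (measurable_betaPDFReal a b).ennreal_ofReal

/-- Density identity behind the substitution `x = s - s t`, `y = s t`, whose Jacobian is `s`. The
endpoints `0` and `1` are excluded because conventions for the densities differ there. -/
lemma gammaPDF_mul_gammaPDF {a b s t : ℝ} (ha : 0 < a) (hb : 0 < b) (hs : 0 < s)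
    (ht0 : t ≠ 0) (ht1 : t ≠ 1) :
    ENNReal.ofReal s * (gammaPDF a 1 (s - s * t) * gammaPDF b 1 (s * t)) =
      gammaPDF (a + b) 1 s * betaPDF b a t := by
  rcases lt_or_gt_of_ne ht0 with h0 | h0
  · rw [gammaPDF_of_neg (x := s * t) (mul_neg_of_pos_of_neg hs h0),
      betaPDF_eq_zero_of_nonpos h0.le]; simp
  rcases lt_or_gt_of_ne ht1 with h1 | h1
  swap
  · rw [gammaPDF_of_neg (x := s - s * t) (by nlinarith),
      betaPDF_eq_zero_of_one_le h1.le]; simp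
  have e1 : s - s * t = s * (1 - t) := by ring
  have h1' : 0 < 1 - t := by linarith
  rw [e1, gammaPDF_of_nonneg (by positivity), gammaPDF_of_nonneg (by positivity),
    gammaPDF_of_nonneg hs.le, betaPDF_of_pos_lt_one h0 h1,
    ← ENNReal.ofReal_mul (by have := Real.Gamma_pos_of_pos ha; positivity),
    ← ENNReal.ofReal_mul hs.le,
    ← ENNReal.ofReal_mul (by have := Real.Gamma_pos_of_pos (add_pos ha hb); positivity)]
  congr 1
  rw [Real.mul_rpow hs.le h1'.le, Real.mul_rpow hs.le h0.le]
  have hG := (Real.Gamma_pos_of_pos ha).ne'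
  have hG' := (Real.Gamma_pos_of_pos hb).ne'
  have hG2 := (Real.Gamma_pos_of_pos (add_pos ha hb)).ne'
  have hexp : Real.exp (-(1 * s)) = Real.exp (-(1 * (s * (1 - t)))) * Real.exp (-(1 * (s * t))) := by
    rw [← Real.exp_add]; ring_nf
  have hpow : s ^ (a + b - 1) = s * s ^ (a - 1) * s ^ (b - 1) := by
    rw [show a + b - 1 = 1 + (a - 1) + (b - 1) by ring, Real.rpow_add hs, Real.rpow_add hs,
      Real.rpow_one]
  rw [hexp, hpow, beta, add_comm b a]
  simp only [Real.one_rpow]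
  field_simp

/-- If `X` and `Y` are independent Gamma variables, then `X + Y` and `Y / (X + Y)` are independent
with a Gamma and a Beta law. -/
theorem map_gammaMeasure_prod_gammaMeasure {a b : ℝ} (ha : 0 < a) (hb : 0 < b) :
    ((gammaMeasure a 1).prod (gammaMeasure b 1)).map (fun p => (p.1 + p.2, p.2 / (p.1 + p.2))) =
      (gammaMeasure (a + b) 1).prod (betaMeasure b a) := by
  have := isProbabilityMeasure_gammaMeasure ha one_pos
  have := isProbabilityMeasure_gammaMeasure hb one_pos
  have := isProbabilityMeasureBeta hb ha
  refine Measure.ext_of_lintegral _ fun F hF => ?_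
  have hm : Measurable fun p : ℝ × ℝ => (p.1 + p.2, p.2 / (p.1 + p.2)) := by fun_prop
  have hga := measurable_gammaPDF a 1
  have hgb := measurable_gammaPDF b 1
  rw [lintegral_map hF hm, lintegral_prod_symm _ (by fun_prop),
    lintegral_prod _ hF.aemeasurable]
  -- For fixed `y`, the shift `x = s - y` makes the sum itself the integration variable.
  have hL : ∀ y, ∫⁻ x, F (x + y, y / (x + y)) ∂gammaMeasure a 1 =
      ∫⁻ s, gammaPDF a 1 (s - y) * F (s, y / s) := by
    intro y
    rw [gammaMeasure, lintegral_withDensity_eq_lintegral_mul _ hga (by fun_prop),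
      ← lintegral_sub_right_eq_self _ y]
    simp
  have hR : ∀ s, ∫⁻ t, F (s, t) ∂betaMeasure b a = ∫⁻ t, betaPDF b a t * F (s, t) := by
    intro s
    rw [betaMeasure, lintegral_withDensity_eq_lintegral_mul _ (measurable_betaPDF b a)
      (by fun_prop)]
    rfl
  simp_rw [hL, hR]
  have hm1 : Measurable fun y => ∫⁻ s, gammaPDF a 1 (s - y) * F (s, y / s) :=
    Measurable.lintegral_prod_right'
      (f := fun p : ℝ × ℝ => gammaPDF a 1 (p.2 - p.1) * F (p.2, p.1 / p.2)) (by fun_prop)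
  have hbeta := measurable_betaPDF b a
  have hm2 : Measurable fun s => ∫⁻ t, betaPDF b a t * F (s, t) :=
    Measurable.lintegral_prod_right'
      (f := fun p : ℝ × ℝ => betaPDF b a p.2 * F p) (by fun_prop)
  rw [gammaMeasure, lintegral_withDensity_eq_lintegral_mul _ hgb hm1, gammaMeasure,
    lintegral_withDensity_eq_lintegral_mul _ (measurable_gammaPDF _ 1) hm2]
  simp only [Pi.mul_apply]
  have hL2 : ∀ y, gammaPDF b 1 y * ∫⁻ s, gammaPDF a 1 (s - y) * F (s, y / s) =
      ∫⁻ s, gammaPDF b 1 y * (gammaPDF a 1 (s - y) * F (s, y / s)) := by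
    intro y
    rw [lintegral_const_mul _ (by fun_prop)]
  simp_rw [hL2]
  rw [lintegral_lintegral_swap (by fun_prop)]
  refine lintegral_congr_ae ?_
  filter_upwards [compl_mem_ae_iff.2 (measure_singleton (0 : ℝ))] with s hs
  rcases lt_or_gt_of_ne (show s ≠ 0 from hs) with h | h
  · rw [gammaPDF_of_neg h, zero_mul, lintegral_eq_zero_iff (by fun_prop)]
    refine ae_of_all _ fun y => ?_
    rcases lt_or_ge y 0 with hy | hy
    · simp [gammaPDF_of_neg hy]
    · simp [gammaPDF_of_neg (show s - y < 0 by linarith)]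
  -- For fixed `s > 0`, the scaling `y = s t` makes the ratio the integration variable.
  · rw [lintegral_comp_mul_left_of_pos h, ← lintegral_const_mul _ (by fun_prop),
      ← lintegral_const_mul _ (by fun_prop)]
    refine lintegral_congr_ae ?_
    filter_upwards [compl_mem_ae_iff.2 (measure_singleton (0 : ℝ)),
      compl_mem_ae_iff.2 (measure_singleton (1 : ℝ))] with t ht0 ht1
    rw [← mul_assoc (gammaPDF (a + b) 1 s), ← gammaPDF_mul_gammaPDF ha hb h ht0 ht1,
      mul_div_cancel_left₀ _ h.ne']
    ring

end

/-! ### Gaussian squares as Gamma variables, and unitary invariance. -/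

section

lemma gammaMeasure_conv_map {a b : ℝ} (ha : 0 < a) (hb : 0 < b) :
    ((gammaMeasure a 1).prod (gammaMeasure b 1)).map (fun p => p.1 + p.2) =
      gammaMeasure (a + b) 1 := by
  have := isProbabilityMeasureBeta hb ha
  have h := congrArg (fun ν => Measure.map Prod.fst ν) (map_gammaMeasure_prod_gammaMeasure ha hb)
  rw [Measure.map_map (by fun_prop) (by fun_prop)] at h
  rw [← Measure.fst, Measure.fst_prod] at h
  exact h

/-- Change of variables `y = x²` on one injective branch. The factor `2` appears because each
half-line carries half of the Gaussian mass. -/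
lemma setLIntegral_sq_gaussian {s : Set ℝ} (hs : MeasurableSet s)
    (hinj : Set.InjOn (fun x : ℝ => x ^ 2) s) (himg : (fun x : ℝ => x ^ 2) '' s = Set.Ioi 0)
    (F : ℝ → ℝ≥0∞) :
    ∫⁻ y in Set.Ioi 0, gammaPDF (1 / 2) 1 y * F y =
      2 * ∫⁻ x in s, gaussianPDF 0 (1 / 2) x * F (x ^ 2) := by
  have h := lintegral_image_eq_lintegral_abs_deriv_mul (s := s) (f := fun x : ℝ => x ^ 2)
    (f' := fun x => 2 * x) hs (fun x _ => by simpa using (hasDerivAt_pow 2 x).hasDerivWithinAt) hinj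
    (fun y => gammaPDF (1 / 2) 1 y * F y)
  rw [himg] at h
  rw [h, ← lintegral_const_mul' _ _ (by simp)]
  refine setLIntegral_congr_fun hs fun x hx => ?_
  have hx2 : 0 < x ^ 2 := by
    have : x ^ 2 ∈ (fun x : ℝ => x ^ 2) '' s := ⟨x, hx, rfl⟩
    rwa [himg] at this
  have hx0 : 0 < |x| := by
    rw [abs_pos]; rintro rfl; simp at hx2
  rw [← mul_assoc, ← mul_assoc]
  congr 1
  rw [gammaPDF_of_nonneg hx2.le, gaussianPDF, ← ENNReal.ofReal_mul (abs_nonneg _),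
    show (2 : ℝ≥0∞) = ENNReal.ofReal 2 by simp, ← ENNReal.ofReal_mul (by norm_num)]
  congr 1
  rw [gaussianPDFReal, Real.Gamma_one_half_eq, ← sq_abs x, ← Real.rpow_natCast |x| 2,
    ← Real.rpow_mul hx0.le, Real.one_rpow, abs_mul]
  have h1 : ((2 : ℕ) : ℝ) * (1 / 2 - 1) = -1 := by norm_num
  rw [h1, Real.rpow_neg_one]
  norm_num
  field_simp

lemma map_sq_gaussianReal :
    (gaussianReal 0 (1 / 2)).map (fun x => x ^ 2) = gammaMeasure (1 / 2) 1 := by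
  refine Measure.ext_of_lintegral _ fun F hF => ?_
  have hv : (1 / 2 : NNReal) ≠ 0 := by norm_num
  have hg := measurable_gammaPDF (1 / 2) 1
  have hφ := measurable_gaussianPDF 0 (1 / 2)
  rw [lintegral_map hF (by fun_prop), gaussianReal_of_var_ne_zero _ hv, gammaMeasure,
    lintegral_withDensity_eq_lintegral_mul _ hg hF,
    lintegral_withDensity_eq_lintegral_mul _ hφ (g := fun x => F (x ^ 2)) (by fun_prop)]
  simp only [Pi.mul_apply]
  have split : ∀ f : ℝ → ℝ≥0∞, ∫⁻ x, f x = (∫⁻ x in Set.Iio 0, f x) + ∫⁻ x in Set.Ioi 0, f x := by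
    intro f
    rw [← lintegral_add_compl f (measurableSet_Iio (a := (0 : ℝ))), Set.compl_Iio,
      setLIntegral_congr Ioi_ae_eq_Ici]
  have hneg : Set.InjOn (fun x : ℝ => x ^ 2) (Set.Iio 0) := by
    intro x hx y hy hxy
    have hx' : x < 0 := hx
    have hy' : y < 0 := hy
    simp only [sq_eq_sq_iff_eq_or_eq_neg] at hxy
    rcases hxy with h | h <;> linarith
  have hpos : Set.InjOn (fun x : ℝ => x ^ 2) (Set.Ioi 0) := by
    intro x hx y hy hxy
    have hx' : 0 < x := hx
    have hy' : 0 < y := hy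
    simp only [sq_eq_sq_iff_eq_or_eq_neg] at hxy
    rcases hxy with h | h <;> linarith
  have hneg' : (fun x : ℝ => x ^ 2) '' (Set.Iio 0) = Set.Ioi 0 := by
    ext y
    constructor
    · rintro ⟨x, hx, rfl⟩
      have hx' : x ≠ 0 := ne_of_lt hx
      exact Set.mem_Ioi.2 (by positivity)
    · intro hy
      exact ⟨-√y, by simpa using Real.sqrt_pos.2 hy, by simp [Real.sq_sqrt (le_of_lt hy)]⟩
  have hpos' : (fun x : ℝ => x ^ 2) '' (Set.Ioi 0) = Set.Ioi 0 := by
    ext y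
    constructor
    · rintro ⟨x, hx, rfl⟩
      exact pow_pos (Set.mem_Ioi.1 hx) 2
    · intro hy
      exact ⟨√y, Real.sqrt_pos.2 hy, by simp [Real.sq_sqrt (le_of_lt hy)]⟩
  have e1 := setLIntegral_sq_gaussian measurableSet_Iio hneg hneg' F
  have e2 := setLIntegral_sq_gaussian measurableSet_Ioi hpos hpos' F
  rw [split, split (fun y => gammaPDF (1 / 2) 1 y * F y)]
  have e0 : ∫⁻ x in Set.Iio 0, gammaPDF (1 / 2) 1 x * F x = 0 := by
    rw [setLIntegral_congr_fun (g := 0) measurableSet_Iio, Pi.zero_def, lintegral_zero]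
    intro x hx
    simp [gammaPDF_of_neg hx]
  rw [e0, zero_add]
  have e3 := e1.symm.trans e2
  rw [ENNReal.mul_right_inj (by simp) (by simp)] at e3
  rw [e3, e2, two_mul]

instance : IsProbabilityMeasure stdComplexGaussian :=
  Measure.isProbabilityMeasure_map (Complex.measurableEquivRealProd.symm.measurable.aemeasurable)

lemma measurable_complex_mk : Measurable fun p : ℝ × ℝ => (⟨p.1, p.2⟩ : ℂ) :=
  Complex.measurableEquivRealProd.symm.measurable

/-- Real and imaginary parts have Gamma squares of shape `1 / 2`, and shapes add under independent
sums. -/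
lemma map_norm_sq_stdComplexGaussian :
    stdComplexGaussian.map (fun z => ‖z‖ ^ 2) = gammaMeasure 1 1 := by
  have h := gammaMeasure_conv_map (a := 1 / 2) (b := 1 / 2) (by norm_num) (by norm_num)
  rw [← map_sq_gaussianReal, Measure.map_prod_map _ _ (by fun_prop) (by fun_prop),
    Measure.map_map (by fun_prop) (by fun_prop)] at h
  rw [stdComplexGaussian, Measure.map_map (by fun_prop) measurable_complex_mk]
  norm_num at h
  rw [← h]
  congr 1
  ext p
  simp only [Function.comp_apply, Prod.map]
  rw [Complex.sq_norm, Complex.normSq_apply]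
  ring

lemma charFun_stdComplexGaussian (t : ℂ) :
    charFun stdComplexGaussian t = Complex.exp (-(‖t‖ ^ 2 / 4 : ℝ)) := by
  have h : ∀ p : ℝ × ℝ, Complex.exp ((inner ℝ (⟨p.1, p.2⟩ : ℂ) t : ℝ) * Complex.I) =
      Complex.exp ((inner ℝ p.1 t.re : ℝ) * Complex.I) *
        Complex.exp ((inner ℝ p.2 t.im : ℝ) * Complex.I) := by
    intro p
    rw [← Complex.exp_add]
    congr 1
    rw [Complex.inner]
    simp
    ring
  rw [charFun_apply, stdComplexGaussian, integral_map measurable_complex_mk.aemeasurable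
    (by fun_prop)]
  simp_rw [h]
  rw [integral_prod_mul (fun x : ℝ => Complex.exp ((inner ℝ x t.re : ℝ) * Complex.I))
    (fun x : ℝ => Complex.exp ((inner ℝ x t.im : ℝ) * Complex.I)), ← charFun_apply, ← charFun_apply,
    charFun_gaussianReal, charFun_gaussianReal, ← Complex.exp_add]
  congr 1
  rw [Complex.sq_norm, Complex.normSq_apply]
  push_cast
  ring

variable {M : ℕ}

instance : IsProbabilityMeasure (complexGaussianVec M) :=
  Measure.isProbabilityMeasure_map (by fun_prop)

/-- Dependence on `t` through `‖t‖` alone is what yields unitary invariance. -/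
lemma charFun_complexGaussianVec (t : EuclideanSpace ℂ (Fin M)) :
    charFun (complexGaussianVec M) t = Complex.exp (-(‖t‖ ^ 2 / 4 : ℝ)) := by
  rw [complexGaussianVec, charFun_pi]
  simp_rw [charFun_stdComplexGaussian, ← Complex.exp_sum]
  rw [EuclideanSpace.norm_sq_eq, Finset.sum_div]
  push_cast
  rw [Finset.sum_neg_distrib]

/-- Unitary invariance of the standard complex Gaussian law. -/
lemma map_complexGaussianVec
    (U : EuclideanSpace ℂ (Fin M) ≃ₗᵢ[ℂ] EuclideanSpace ℂ (Fin M)) :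
    (complexGaussianVec M).map U = complexGaussianVec M := by
  have hprob : IsProbabilityMeasure ((complexGaussianVec M).map U) :=
    Measure.isProbabilityMeasure_map (by fun_prop)
  -- The characteristic function uses the real inner product, so `U` is regarded as a real isometry
  -- and moved onto `t`.
  let V : EuclideanSpace ℂ (Fin M) ≃ₗᵢ[ℝ] EuclideanSpace ℂ (Fin M) :=
    { U.toLinearEquiv.restrictScalars ℝ with norm_map' := U.norm_map }
  refine Measure.ext_of_charFun ?_
  ext t
  rw [charFun_apply, integral_map (by fun_prop) (by fun_prop)]
  have h : ∀ x, inner ℝ (U x) t = inner ℝ x (V.symm t) := by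
    intro x
    have := V.inner_map_map x (V.symm t)
    rw [V.apply_symm_apply] at this
    exact this
  simp_rw [h]
  rw [← charFun_apply, charFun_complexGaussianVec, charFun_complexGaussianVec, V.symm.norm_map]

end

/-! ### Norm and angle of a Gaussian vector relative to a fixed subspace. -/

section

variable {M : ℕ}

lemma sin_sq_subspaceAngle (v : EuclideanSpace ℂ (Fin M))
    (S : Submodule ℂ (EuclideanSpace ℂ (Fin M))) :
    Real.sin (subspaceAngle v S) ^ 2 = 1 - ‖S.starProjection v‖ ^ 2 / ‖v‖ ^ 2 := by
  have h0 : 0 ≤ ‖S.starProjection v‖ / ‖v‖ := by positivity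
  have h1 : ‖S.starProjection v‖ / ‖v‖ ≤ 1 :=
    div_le_one_of_le₀ (S.norm_starProjection_apply_le v) (norm_nonneg _)
  rw [subspaceAngle, Real.sin_arccos, Real.sq_sqrt, div_pow]
  have := mul_le_one₀ h1 h0 h1
  nlinarith

lemma norm_sq_mul_sin_sq_subspaceAngle (v : EuclideanSpace ℂ (Fin M))
    (S : Submodule ℂ (EuclideanSpace ℂ (Fin M))) :
    ‖v‖ ^ 2 * Real.sin (subspaceAngle v S) ^ 2 = ‖Sᗮ.starProjection v‖ ^ 2 := by
  rw [sin_sq_subspaceAngle]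
  have h := S.norm_sq_eq_add_norm_sq_starProjection v
  rcases eq_or_ne v 0 with rfl | hv
  · simp
  · have : ‖v‖ ≠ 0 := norm_ne_zero_iff.2 hv
    field_simp
    linarith

/-- In an adapted basis the squared projection is a partial sum of squared coordinates, hence
independent of the remaining ones. -/
lemma exists_orthonormalBasis_norm_sq_starProjection
    (S : Submodule ℂ (EuclideanSpace ℂ (Fin M))) :
    ∃ (b : OrthonormalBasis (Fin M) ℂ (EuclideanSpace ℂ (Fin M))) (s : Finset (Fin M)),
      s.card = Module.finrank ℂ S ∧
        ∀ v, ‖S.starProjection v‖ ^ 2 = ∑ i ∈ s, ‖b.repr v i‖ ^ 2 := by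
  have hj : Module.finrank ℂ S ≤ M := by simpa using S.finrank_le
  let bS := stdOrthonormalBasis ℂ S
  let e : Fin (Module.finrank ℂ S) ↪ Fin M := Fin.castLEEmb hj
  let w : Fin M → EuclideanSpace ℂ (Fin M) :=
    -- The value `0` is a filler: orthonormality is only asked on the range of `e`.
    fun i => if h : (i : ℕ) < Module.finrank ℂ S then bS ⟨i, h⟩ else 0
  have hw : ∀ i, w (e i) = bS i := fun i => by simp [w, e]
  obtain ⟨b, hb⟩ := Orthonormal.exists_orthonormalBasis_extension_of_card_eq (𝕜 := ℂ)
    (v := w) (s := Set.range e) (by simp) (by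
      have h1 : Orthonormal ℂ (fun i => (bS i : EuclideanSpace ℂ (Fin M))) :=
        bS.orthonormal.comp_linearIsometry S.subtypeₗᵢ
      rw [orthonormal_iff_ite] at h1 ⊢
      rintro ⟨_, i, rfl⟩ ⟨_, j, rfl⟩
      have := h1 i j
      simp only [Set.domRestrict_apply, hw, this, Subtype.ext_iff, e.injective.eq_iff])
  refine ⟨b, Finset.univ.map e, by simp, fun v => ?_⟩
  rw [Finset.sum_map, S.starProjection_apply, ← Submodule.coe_norm, ← bS.sum_sq_norm_inner_right]
  refine Finset.sum_congr rfl fun i _ => ?_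
  rw [b.repr_apply_apply, hb _ ⟨i, rfl⟩, hw, Submodule.inner_orthogonalProjectionOnto_eq_of_mem_left]

lemma map_sum_eq_gammaMeasure {Ω ι : Type*} [MeasurableSpace Ω] {P : Measure Ω}
    [IsProbabilityMeasure P] {X : ι → Ω → ℝ} (hX : ∀ i, Measurable (X i)) (hind : iIndepFun X P)
    (hlaw : ∀ i, P.map (X i) = gammaMeasure 1 1) {s : Finset ι} (hs : s.Nonempty) :
    P.map (fun ω => ∑ i ∈ s, X i ω) = gammaMeasure s.card 1 := by
  classical
  induction hs using Finset.Nonempty.cons_induction with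
  | singleton a => simpa using hlaw a
  | cons a s ha hs ih =>
    have h1 : IndepFun (fun ω => ∑ i ∈ s, X i ω) (X a) P := by
      have := hind.indepFun_finsetSum_of_notMem hX ha
      convert! this using 2
      simp
    have h2 := (indepFun_iff_map_prod_eq_prod_map_map (by fun_prop) (by fun_prop)).1 h1
    rw [ih, hlaw] at h2
    have h3 := congrArg (fun ν => Measure.map (fun p : ℝ × ℝ => p.1 + p.2) ν) h2
    rw [gammaMeasure_conv_map (by exact_mod_cast hs.card_pos) one_pos,
      Measure.map_map (by fun_prop) (by fun_prop)] at h3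
    rw [Finset.card_cons, Nat.cast_add, Nat.cast_one, ← h3]
    congr 1
    ext ω
    simp only [Function.comp_apply, Finset.sum_cons, add_comm]

lemma indepFun_sum_sum {Ω ι : Type*} [MeasurableSpace Ω] {P : Measure Ω} {X : ι → Ω → ℝ}
    (hX : ∀ i, Measurable (X i)) (hind : iIndepFun X P) {s t : Finset ι} (hst : Disjoint s t) :
    IndepFun (fun ω => ∑ i ∈ s, X i ω) (fun ω => ∑ i ∈ t, X i ω) P := by
  have h := (hind.indepFun_finset s t hst hX).comp
    (φ := fun x : s → ℝ => ∑ i, x i) (ψ := fun x : t → ℝ => ∑ i, x i) (by fun_prop) (by fun_prop)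
  convert! h using 1
  · ext ω; simp [Finset.sum_attach s (fun i => X i ω)]
  · ext ω; simp [Finset.sum_attach t (fun i => X i ω)]

lemma map_norm_sq_coord (i : Fin M) :
    (complexGaussianVec M).map (fun v => ‖v i‖ ^ 2) = gammaMeasure 1 1 := by
  have h := (measurePreserving_eval (fun _ : Fin M => stdComplexGaussian) i).map_eq
  rw [← map_norm_sq_stdComplexGaussian, ← h, complexGaussianVec,
    Measure.map_map (by fun_prop) (by fun_prop), Measure.map_map (by fun_prop) (by fun_prop)]
  rfl

lemma iIndepFun_norm_sq_coord :
    iIndepFun (fun (i : Fin M) (v : EuclideanSpace ℂ (Fin M)) => ‖v i‖ ^ 2)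
      (complexGaussianVec M) := by
  have h := iIndepFun_pi (μ := fun _ : Fin M => stdComplexGaussian)
    (X := fun _ z => ‖z‖ ^ 2) (fun i => by fun_prop)
  rw [iIndepFun_iff_map_fun_eq_pi_map
    (fun i => Measurable.aemeasurable (by fun_prop))] at h ⊢
  simp_rw [map_norm_sq_coord]
  rw [complexGaussianVec, Measure.map_map (by fun_prop) (by fun_prop)]
  convert! h using 2
  ext1 i
  rw [← map_norm_sq_coord i, complexGaussianVec, Measure.map_map (by fun_prop) (by fun_prop)]
  rfl

lemma map_norm_sq_complexGaussianVec (hM : 0 < M) :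
    (complexGaussianVec M).map (fun v => ‖v‖ ^ 2) = gammaMeasure M 1 := by
  have : Nonempty (Fin M) := ⟨⟨0, hM⟩⟩
  have h := map_sum_eq_gammaMeasure (fun i => by fun_prop) (iIndepFun_norm_sq_coord (M := M))
    map_norm_sq_coord (s := Finset.univ) Finset.univ_nonempty
  simp_rw [← EuclideanSpace.norm_sq_eq] at h
  simpa using h

lemma gammaMeasure_singleton (a r x : ℝ) : gammaMeasure a r {x} = 0 :=
  withDensity_absolutelyContinuous _ _ (by simp)

lemma ae_ne_zero_complexGaussianVec (hM : 0 < M) : ∀ᵐ v ∂complexGaussianVec M, v ≠ 0 := by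
  have h := gammaMeasure_singleton M 1 0
  rw [← map_norm_sq_complexGaussianVec hM, Measure.map_apply (by fun_prop) (by simp)] at h
  rw [ae_iff]
  convert! h using 2
  ext v; simp

/-- The law of `sin²` of the angle between a standard complex Gaussian vector in `ℂ ^ M` and a
fixed subspace of dimension `j`. -/
noncomputable def sinSqLaw (M j : ℕ) : Measure ℝ :=
  if j = 0 then Measure.dirac 1 else betaMeasure ((M : ℝ) - j) j

lemma isProbabilityMeasure_sinSqLaw {j : ℕ} (hj : j < M) : IsProbabilityMeasure (sinSqLaw M j) := by
  unfold sinSqLaw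
  split_ifs with h
  · infer_instance
  · exact isProbabilityMeasureBeta (by simpa using hj) (by positivity)

lemma measurable_sin_sq_subspaceAngle (S : Submodule ℂ (EuclideanSpace ℂ (Fin M))) :
    Measurable fun v => Real.sin (subspaceAngle v S) ^ 2 := by
  simp_rw [sin_sq_subspaceAngle]
  fun_prop

/-- The squared norm of a standard complex Gaussian vector is independent of its angle to a fixed
subspace. -/
theorem map_norm_sq_sin_sq (S : Submodule ℂ (EuclideanSpace ℂ (Fin M)))
    (hS : Module.finrank ℂ S < M) :
    (complexGaussianVec M).map (fun v => (‖v‖ ^ 2, Real.sin (subspaceAngle v S) ^ 2)) =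
      (gammaMeasure M 1).prod (sinSqLaw M (Module.finrank ℂ S)) := by
  have hM : 0 < M := by omega
  unfold sinSqLaw
  split_ifs with h0
  · have : S = ⊥ := Submodule.finrank_eq_zero.1 h0
    subst this
    have e : (fun v : EuclideanSpace ℂ (Fin M) =>
        (‖v‖ ^ 2, Real.sin (subspaceAngle v ⊥) ^ 2)) = fun v => (‖v‖ ^ 2, 1) := by
      ext v <;> simp [sin_sq_subspaceAngle]
    have := isProbabilityMeasure_gammaMeasure (a := M) (by exact_mod_cast hM) one_pos
    rw [e, Measure.prod_dirac, ← map_norm_sq_complexGaussianVec hM,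
      Measure.map_map (by fun_prop) (by fun_prop)]
    rfl
  · obtain ⟨b, s, hs, hb⟩ := exists_orthonormalBasis_norm_sq_starProjection S
    have hcard : (sᶜ.card : ℝ) = (M : ℝ) - Module.finrank ℂ S := by
      rw [Finset.card_compl, hs, Fintype.card_fin, Nat.cast_sub hS.le]
    have hs1 : s.Nonempty := Finset.card_pos.1 (by omega)
    have hs2 : sᶜ.Nonempty := Finset.card_pos.1 (by
      rw [Finset.card_compl, hs, Fintype.card_fin]; omega)
    let A : EuclideanSpace ℂ (Fin M) → ℝ := fun w => ∑ i ∈ s, ‖w i‖ ^ 2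
    let B : EuclideanSpace ℂ (Fin M) → ℝ := fun w => ∑ i ∈ sᶜ, ‖w i‖ ^ 2
    have hA : Measurable A := by fun_prop
    have hB : Measurable B := by fun_prop
    have hAB : ∀ w, A w + B w = ‖w‖ ^ 2 := fun w => by
      rw [EuclideanSpace.norm_sq_eq, Finset.sum_add_sum_compl]
    -- `A` and `B` are the squared lengths inside and outside `S`. The ratio formula for `sin²`
    -- needs `v ≠ 0`, which holds almost surely.
    have e : (fun v : EuclideanSpace ℂ (Fin M) => (‖v‖ ^ 2, Real.sin (subspaceAngle v S) ^ 2))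
        =ᵐ[complexGaussianVec M] (fun w => (A w + B w, B w / (A w + B w))) ∘ b.repr := by
      filter_upwards [ae_ne_zero_complexGaussianVec hM] with v hv
      have hv' : ‖v‖ ^ 2 ≠ 0 := by simpa using hv
      have h1 := hAB (b.repr v)
      rw [b.repr.norm_map] at h1
      simp only [Function.comp_apply, h1, sin_sq_subspaceAngle, hb]
      congr 1
      rw [eq_div_iff hv', sub_mul, div_mul_cancel₀ _ hv', ← h1]
      simp only [A]
      ring
    rw [Measure.map_congr e, ← Measure.map_map (by fun_prop) (by fun_prop),
      map_complexGaussianVec b.repr]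
    have hind := (indepFun_iff_map_prod_eq_prod_map_map (by fun_prop) (by fun_prop)).1
      (indepFun_sum_sum (fun i => by fun_prop) (iIndepFun_norm_sq_coord (M := M))
        (disjoint_compl_right (a := s)))
    rw [map_sum_eq_gammaMeasure (fun i => by fun_prop) iIndepFun_norm_sq_coord
      map_norm_sq_coord hs1, map_sum_eq_gammaMeasure (fun i => by fun_prop)
      iIndepFun_norm_sq_coord map_norm_sq_coord hs2] at hind
    have h := map_gammaMeasure_prod_gammaMeasure (a := s.card) (b := sᶜ.card)
      (by exact_mod_cast hs1.card_pos) (by exact_mod_cast hs2.card_pos)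
    rw [← hind, Measure.map_map (by fun_prop) (by fun_prop), hcard, hs, add_sub_cancel] at h
    rw [← h]
    rfl

end

/-! ### Random subspaces: measurability, general position, and integrating out one vector. -/

section

variable {M : ℕ}

lemma lintegral_pi_eq_lintegral_update {ι X : Type*} [Fintype ι] [DecidableEq ι]
    [MeasurableSpace X] (μ : Measure X) [IsProbabilityMeasure μ] (k : ι) {f : (ι → X) → ℝ≥0∞}
    (hf : Measurable f) :
    ∫⁻ h, f h ∂Measure.pi (fun _ => μ) =
      ∫⁻ h, ∫⁻ v, f (Function.update h k v) ∂μ ∂Measure.pi (fun _ => μ) := by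
  have hg : Measurable fun h => ∫⁻ v, f (Function.update h k v) ∂μ := by
    have := hf.lmarginal (fun _ => μ) (s := {k})
    simpa only [lmarginal_singleton] using this
  refine lintegral_eq_of_lmarginal_eq {k} hf hg ?_
  ext h
  simp [lmarginal_singleton]

/-- The projection onto a span is discontinuous in the spanning vectors. Written as an infimum of
functions continuous in `(u, v)`, the distance to the span is upper semicontinuous, hence
measurable. -/
lemma enorm_starProjection_orthogonal {n : ℕ} (u : Fin n → EuclideanSpace ℂ (Fin M))
    (v : EuclideanSpace ℂ (Fin M)) :
    ‖(Submodule.span ℂ (Set.range u))ᗮ.starProjection v‖ₑ = ⨅ c : Fin n → ℂ, ‖v - ∑ l, c l • u l‖ₑ := by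
  set S := Submodule.span ℂ (Set.range u)
  have h1 : Sᗮ.starProjection v = v - S.starProjection v := by
    rw [eq_sub_iff_add_eq', S.starProjection_add_starProjection_orthogonal]
  apply le_antisymm
  · refine le_iInf fun c => ?_
    have hmem : ∑ l, c l • u l ∈ S :=
      Submodule.sum_mem _ fun l _ => S.smul_mem _ (Submodule.subset_span ⟨l, rfl⟩)
    have h2 : Sᗮ.starProjection v = Sᗮ.starProjection (v - ∑ l, c l • u l) := by
      rw [map_sub, (Submodule.starProjection_apply_eq_zero_iff _).2 (S.le_orthogonal_orthogonal hmem),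
        sub_zero]
    rw [h2, enorm_le_iff_norm_le]
    exact Sᗮ.norm_starProjection_apply_le _
  · obtain ⟨c, hc⟩ := (Submodule.mem_span_range_iff_exists_fun ℂ).1 (S.starProjection_apply_mem v)
    refine iInf_le_of_le c ?_
    rw [hc, h1]

lemma measurable_sin_sq_subspaceAngle_span (n : ℕ) :
    Measurable fun p : EuclideanSpace ℂ (Fin M) × (Fin n → EuclideanSpace ℂ (Fin M)) =>
      Real.sin (subspaceAngle p.1 (Submodule.span ℂ (Set.range p.2))) ^ 2 := by
  have h1 : Measurable fun p : EuclideanSpace ℂ (Fin M) × (Fin n → EuclideanSpace ℂ (Fin M)) =>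
      ‖(Submodule.span ℂ (Set.range p.2))ᗮ.starProjection p.1‖ₑ := by
    simp_rw [enorm_starProjection_orthogonal]
    refine UpperSemicontinuous.measurable (upperSemicontinuous_iInf fun c => ?_)
    exact Continuous.upperSemicontinuous (by fun_prop)
  have h2 : ∀ p : EuclideanSpace ℂ (Fin M) × (Fin n → EuclideanSpace ℂ (Fin M)),
      Real.sin (subspaceAngle p.1 (Submodule.span ℂ (Set.range p.2))) ^ 2 =
        1 - (‖p.1‖ ^ 2 -
          ‖(Submodule.span ℂ (Set.range p.2))ᗮ.starProjection p.1‖ₑ.toReal ^ 2) / ‖p.1‖ ^ 2 := by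
    intro p
    rw [sin_sq_subspaceAngle, toReal_enorm,
      (Submodule.span ℂ (Set.range p.2)).norm_sq_eq_add_norm_sq_starProjection p.1]
    ring
  simp_rw [h2]
  fun_prop

lemma sinSqLaw_singleton_zero (M j : ℕ) : sinSqLaw M j {0} = 0 := by
  unfold sinSqLaw
  split_ifs
  · simp
  · exact withDensity_absolutelyContinuous _ _ (by simp)

lemma map_sin_sq (S : Submodule ℂ (EuclideanSpace ℂ (Fin M))) (hS : Module.finrank ℂ S < M) :
    (complexGaussianVec M).map (fun v => Real.sin (subspaceAngle v S) ^ 2) =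
      sinSqLaw M (Module.finrank ℂ S) := by
  have := isProbabilityMeasure_gammaMeasure (a := M) (r := 1)
    (by exact_mod_cast (Nat.zero_le _).trans_lt hS) one_pos
  have := isProbabilityMeasure_sinSqLaw hS
  have h := congrArg (fun ν => Measure.map Prod.snd ν) (map_norm_sq_sin_sq S hS)
  rw [Measure.map_map (by fun_prop)
    ((by fun_prop : Measurable _).prodMk (measurable_sin_sq_subspaceAngle S)),
    ← Measure.snd, Measure.snd_prod] at h
  exact h

lemma ae_notMem_complexGaussianVec (S : Submodule ℂ (EuclideanSpace ℂ (Fin M)))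
    (hS : Module.finrank ℂ S < M) : ∀ᵐ v ∂complexGaussianVec M, v ∉ S := by
  have h0 := sinSqLaw_singleton_zero M (Module.finrank ℂ S)
  rw [← map_sin_sq S hS, Measure.map_apply (measurable_sin_sq_subspaceAngle S) (by simp)] at h0
  have h1 : ∀ᵐ v ∂complexGaussianVec M, Real.sin (subspaceAngle v S) ^ 2 ≠ 0 := by
    simpa only [ae_iff, not_not] using! h0
  filter_upwards [h1, ae_ne_zero_complexGaussianVec ((Nat.zero_le _).trans_lt hS)] with v hv hv0 hmem
  refine hv ?_
  rw [sin_sq_subspaceAngle, Submodule.starProjection_eq_self_iff.2 hmem, div_self, sub_self]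
  simpa using hv0

/-- Each new vector almost surely avoids the span of the others, a proper subspace and thus a null
set. -/
lemma ae_linearIndependent {n : ℕ} (hn : n ≤ M) :
    ∀ᵐ h ∂Measure.pi (fun _ : Fin n => complexGaussianVec M), LinearIndependent ℂ h := by
  induction n with
  | zero => exact ae_of_all _ fun h => linearIndependent_empty_type
  | succ n ih =>
    have hp := measurePreserving_piFinSuccAbove (fun _ : Fin (n + 1) => complexGaussianVec M) 0
    have hset : MeasurableSet {p : EuclideanSpace ℂ (Fin M) × (Fin n → EuclideanSpace ℂ (Fin M)) |
        LinearIndependent ℂ (Fin.cons p.1 p.2 : Fin (n + 1) → EuclideanSpace ℂ (Fin M))} := by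
      refine (isOpen_setOfPred_linearIndependent.preimage (f := fun p : EuclideanSpace ℂ (Fin M) ×
        (Fin n → EuclideanSpace ℂ (Fin M)) => (Fin.cons p.1 p.2 : Fin (n + 1) → _)) ?_).measurableSet
      fun_prop
    have key : ∀ᵐ p ∂(complexGaussianVec M).prod
        (Measure.pi (fun _ : Fin n => complexGaussianVec M)),
        LinearIndependent ℂ (Fin.cons p.1 p.2 : Fin (n + 1) → EuclideanSpace ℂ (Fin M)) := by
      -- The quantifiers are swapped so that the span is frozen before the new vector is drawn.
      rw [Measure.ae_prod_iff_ae_ae hset, Measure.ae_ae_comm hset]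
      filter_upwards [ih (by omega)] with h hh
      have hfin : Module.finrank ℂ (Submodule.span ℂ (Set.range h)) < M := by
        rw [finrank_span_eq_card hh, Fintype.card_fin]; omega
      filter_upwards [ae_notMem_complexGaussianVec _ hfin] with v hv
      exact linearIndependent_finCons.2 ⟨hh, hv⟩
    have := hp.quasiMeasurePreserving.ae key
    filter_upwards [this] with h hh
    convert! hh using 1
    ext i : 1
    refine Fin.cases ?_ (fun j => ?_) i <;> rfl

lemma map_comp_pi {ι κ X : Type*} [Fintype ι] [Fintype κ] [MeasurableSpace X]
    (μ : Measure X) [IsProbabilityMeasure μ] {f : κ → ι} (hf : f.Injective) :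
    (Measure.pi fun _ : ι => μ).map (fun h => h ∘ f) = Measure.pi fun _ : κ => μ := by
  have h1 : iIndepFun (fun (i : ι) (h : ι → X) => h i) (Measure.pi fun _ : ι => μ) :=
    iIndepFun_pi (X := fun _ x => x) (fun _ => aemeasurable_id)
  have h2 := (iIndepFun_iff_map_fun_eq_pi_map
    (fun i => (measurable_pi_apply _).aemeasurable)).1 (h1.precomp hf)
  have h3 : ∀ i, (Measure.pi fun _ : ι => μ).map (fun h => h i) = μ :=
    fun i => (measurePreserving_eval (fun _ : ι => μ) i).map_eq
  simp_rw [h3] at h2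
  exact h2

lemma ae_linearIndependent_comp {K n : ℕ} (hn : n ≤ M) {f : Fin n → Fin K} (hf : f.Injective) :
    ∀ᵐ h ∂Measure.pi (fun _ : Fin K => complexGaussianVec M), LinearIndependent ℂ (h ∘ f) := by
  have h := ae_linearIndependent (M := M) hn
  rw [← map_comp_pi (complexGaussianVec M) hf] at h
  exact ae_of_ae_map (f := fun h : Fin K → EuclideanSpace ℂ (Fin M) => h ∘ f)
    (p := fun h => LinearIndependent ℂ h)
    (measurable_pi_lambda _ fun _ => measurable_pi_apply _).aemeasurable h

/-- Integrating out the `k`-th vector, whose norm is independent of its angle to the span of the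
other ones. -/
theorem lintegral_mul_sin_sq {K n : ℕ} (hn : n < M) (k : Fin K) {f : Fin n → Fin K}
    (hf : f.Injective) (hfk : ∀ i, f i ≠ k) {φ : (Fin K → EuclideanSpace ℂ (Fin M)) → ℝ≥0∞}
    (hφ : Measurable φ) (hnorm : ∀ h v w, ‖v‖ = ‖w‖ →
      φ (Function.update h k v) = φ (Function.update h k w)) {ψ : ℝ → ℝ≥0∞} (hψ : Measurable ψ) :
    ∫⁻ h, φ h * ψ (Real.sin (subspaceAngle (h k) (Submodule.span ℂ (Set.range (h ∘ f)))) ^ 2)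
        ∂Measure.pi (fun _ : Fin K => complexGaussianVec M) =
      (∫⁻ h, φ h ∂Measure.pi (fun _ : Fin K => complexGaussianVec M)) *
        ∫⁻ s, ψ s ∂sinSqLaw M n := by
  have hM : 0 < M := by omega
  have hm : Measurable fun h : Fin K → EuclideanSpace ℂ (Fin M) =>
      Real.sin (subspaceAngle (h k) (Submodule.span ℂ (Set.range (h ∘ f)))) ^ 2 :=
    (measurable_sin_sq_subspaceAngle_span n).comp
      (g := fun p => _) (f := fun h : Fin K → EuclideanSpace ℂ (Fin M) => (h k, h ∘ f))
      (by fun_prop)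
  have := isProbabilityMeasure_gammaMeasure (a := M) (r := 1) (by exact_mod_cast hM) one_pos
  have := isProbabilityMeasure_sinSqLaw hn
  have hm' := hψ.comp hm
  rw [Function.comp_def] at hm'
  rw [lintegral_pi_eq_lintegral_update _ k (hφ.fun_mul hm'),
    lintegral_pi_eq_lintegral_update _ k hφ, ← lintegral_mul_const _ (by
      have := hφ.lmarginal (fun _ => complexGaussianVec M) (s := {k})
      simpa only [lmarginal_singleton] using this)]
  refine lintegral_congr_ae ?_
  -- Independence gives the frozen span dimension exactly `n`, so the law of `sin²` is the same for
  -- almost every `h`.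
  filter_upwards [ae_linearIndependent_comp hn.le hf] with h hh
  -- A reference unit vector: by `hnorm`, `v` may be replaced by `‖v‖ • e`, which exhibits `φ` as a
  -- function of `‖v‖²`.
  let e : EuclideanSpace ℂ (Fin M) := EuclideanSpace.single ⟨0, hM⟩ 1
  have hφ' : ∀ v, φ (Function.update h k v) =
      φ (Function.update h k ((√(‖v‖ ^ 2) : ℂ) • e)) := by
    intro v
    refine hnorm h _ _ ?_
    simp [e, norm_smul, Real.sqrt_sq]
  have hmeas : Measurable fun t : ℝ => φ (Function.update h k ((√t : ℂ) • e)) := by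
    refine hφ.comp ((measurable_update h).comp ?_)
    fun_prop
  have hcomp : ∀ v, Function.update h k v ∘ f = h ∘ f := fun v => by
    ext1 i
    simp [hfk]
  have hS : Module.finrank ℂ (Submodule.span ℂ (Set.range (h ∘ f))) = n := by
    rw [finrank_span_eq_card hh, Fintype.card_fin]
  simp only [Function.update_self, hcomp]
  have key := map_norm_sq_sin_sq (Submodule.span ℂ (Set.range (h ∘ f))) (hS.trans_lt hn)
  rw [hS] at key
  calc ∫⁻ v, φ (Function.update h k v) *
        ψ (Real.sin (subspaceAngle v (Submodule.span ℂ (Set.range (h ∘ f)))) ^ 2)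
          ∂complexGaussianVec M
      = ∫⁻ v, φ (Function.update h k ((√(‖v‖ ^ 2) : ℂ) • e)) *
        ψ (Real.sin (subspaceAngle v (Submodule.span ℂ (Set.range (h ∘ f)))) ^ 2)
          ∂complexGaussianVec M := lintegral_congr fun v => by rw [← hφ' v]
    _ = ∫⁻ p, φ (Function.update h k ((√p.1 : ℂ) • e)) * ψ p.2
          ∂(gammaMeasure M 1).prod (sinSqLaw M n) := by
        rw [← key, lintegral_map (by fun_prop)
          ((by fun_prop : Measurable _).prodMk (measurable_sin_sq_subspaceAngle _))]
    _ = (∫⁻ t, φ (Function.update h k ((√t : ℂ) • e)) ∂gammaMeasure M 1) *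
          ∫⁻ s, ψ s ∂sinSqLaw M n := lintegral_prod_mul hmeas.aemeasurable hψ.aemeasurable
    _ = _ := by
        rw [← map_norm_sq_complexGaussianVec hM, lintegral_map hmeas (by fun_prop)]
        simp_rw [← hφ']

lemma sinSqAngle_eq {n : ℕ} (g : Fin n → EuclideanSpace ℂ (Fin M)) (i : Fin n) :
    sinSqAngle g i = Real.sin (subspaceAngle (g i)
      (Submodule.span ℂ (Set.range (g ∘ Fin.castLE i.2.le)))) ^ 2 := by
  rw [sinSqAngle, interferenceSpan]
  congr 4
  ext x
  constructor
  · rintro ⟨j, hj, rfl⟩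
    exact ⟨⟨j, hj⟩, rfl⟩
  · rintro ⟨j, rfl⟩
    exact ⟨Fin.castLE i.2.le j, j.2, rfl⟩

lemma measurable_sinSqAngle {n : ℕ} (i : Fin n) :
    Measurable fun g : Fin n → EuclideanSpace ℂ (Fin M) => sinSqAngle g i := by
  simp_rw [sinSqAngle_eq]
  exact (measurable_sin_sq_subspaceAngle_span i).comp
      (f := fun h : Fin n → EuclideanSpace ℂ (Fin M) => (h i, h ∘ Fin.castLE i.2.le))
      (by fun_prop)

theorem sinSqAngleLaw_eq {j : ℕ} (hj : j < M) : sinSqAngleLaw M j = sinSqLaw M j := by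
  refine Measure.ext_of_lintegral _ fun ψ hψ => ?_
  rw [sinSqAngleLaw, lintegral_map hψ (measurable_sinSqAngle _)]
  have h := lintegral_mul_sin_sq hj (Fin.last j) (f := Fin.castLE (Nat.le_succ j))
    (Fin.castLE_injective _) (fun i => (Fin.castSucc_lt_last i).ne) (φ := fun _ => 1)
    measurable_const (fun _ _ _ _ => rfl) hψ
  simp only [one_mul, lintegral_one, measure_univ] at h
  rw [← h]
  simp_rw [sinSqAngle_eq]

end

/-! ### Sorting by norm and factorization over ranks. -/

section

variable {M K Ks : ℕ}

/-- Ties are broken by index, so finitely many comparisons determine the permutation. Measurability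
and insensitivity to squaring the norms both follow. -/
lemma descendingOrder_eq_iff {x : Fin K → ℝ} {π : Equiv.Perm (Fin K)} :
    descendingOrder x = π ↔ (∀ i j, i ≤ j → x (π j) ≤ x (π i)) ∧
      ∀ i j, i < j → x (π i) = x (π j) → π i < π j := by
  rw [eq_comm, descendingOrder, Tuple.eq_sort_iff]
  rfl

lemma antitone_comp_descendingOrder (x : Fin K → ℝ) : Antitone (x ∘ descendingOrder x) :=
  fun i j hij => (descendingOrder_eq_iff.1 (rfl : descendingOrder x = _)).1 i j hij

lemma descendingOrder_norm_sq (h : Fin K → EuclideanSpace ℂ (Fin M)) :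
    descendingOrder (fun k => ‖h k‖ ^ 2) = descendingOrder fun k => ‖h k‖ := by
  obtain ⟨h1, h2⟩ := descendingOrder_eq_iff.1 (rfl : descendingOrder (fun k => ‖h k‖) = _)
  refine descendingOrder_eq_iff.2 ⟨fun i j hij => ?_, fun i j hij he => h2 i j hij ?_⟩
  · exact pow_le_pow_left₀ (norm_nonneg _) (h1 i j hij) 2
  · exact (pow_left_inj₀ (norm_nonneg _) (norm_nonneg _) two_ne_zero).1 he

lemma measurableSet_descendingOrder_eq (π : Equiv.Perm (Fin K)) :
    MeasurableSet {x : Fin K → ℝ | descendingOrder x = π} := by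
  have hm : ∀ i, Measurable fun x : Fin K → ℝ => x (π i) := fun i => measurable_pi_apply _
  have e : {x : Fin K → ℝ | descendingOrder x = π} =
      (⋂ (i) (j) (_ : i ≤ j), {x | x (π j) ≤ x (π i)}) ∩
        ⋂ (i) (j) (_ : i < j), ({x | x (π i) = x (π j)}ᶜ ∪ {_x | π i < π j}) := by
    ext x
    simp [descendingOrder_eq_iff, imp_iff_not_or]
  rw [e]
  refine MeasurableSet.inter ?_ ?_
  · exact .iInter fun i => .iInter fun j => .iInter fun _ => measurableSet_le (hm j) (hm i)
  · exact .iInter fun i => .iInter fun j => .iInter fun _ =>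
      (measurableSet_eq_fun (hm i) (hm j)).compl.union (.const _)

lemma measurableSet_descendingOrder_comp_eq {X : Type*} [MeasurableSpace X] {x : X → Fin K → ℝ}
    (hx : Measurable x) (π : Equiv.Perm (Fin K)) :
    MeasurableSet {h | descendingOrder (x h) = π} :=
  hx (measurableSet_descendingOrder_eq π)

lemma measurable_descendingOrder_apply {X β : Type*} [MeasurableSpace X] [MeasurableSpace β]
    {x : X → Fin K → ℝ} (hx : Measurable x) {F : Equiv.Perm (Fin K) → X → β}
    (hF : ∀ π, Measurable (F π)) : Measurable fun h => F (descendingOrder (x h)) h := by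
  let _ : MeasurableSpace (Equiv.Perm (Fin K)) := ⊤
  have : MeasurableSingletonClass (Equiv.Perm (Fin K)) := ⟨fun _ => trivial⟩
  have h1 : Measurable fun h => descendingOrder (x h) :=
    measurable_to_countable' fun π => hx (measurableSet_descendingOrder_eq π)
  exact (measurable_from_prod_countable_right (f := fun p : Equiv.Perm (Fin K) × X => F p.1 p.2)
    hF).comp (h1.prodMk measurable_id)

lemma measurable_norms : Measurable fun (h : Fin K → EuclideanSpace ℂ (Fin M)) k => ‖h k‖ := by
  fun_prop

lemma measurable_nusChannels (hK : Ks ≤ K) : Measurable (nusChannels (M := M) hK) :=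
  measurable_pi_lambda _ fun i => measurable_descendingOrder_apply measurable_norms
    (F := fun π h => h (π (Fin.castLE hK i.rev))) fun _ => measurable_pi_apply _

lemma measurable_normOrderStat (r : Fin K) :
    Measurable fun h : Fin K → EuclideanSpace ℂ (Fin M) =>
      (fun k => ‖h k‖ ^ 2) (descendingOrder (fun k => ‖h k‖ ^ 2) r) :=
  measurable_descendingOrder_apply (x := fun (h : Fin K → EuclideanSpace ℂ (Fin M)) k => ‖h k‖ ^ 2)
    (by fun_prop) (F := fun π h => ‖h (π r)‖ ^ 2) fun _ => by fun_prop

/-- Splitting by the sorting permutation turns random ranks into fixed user indices. -/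
lemma lintegral_descendingOrder {X : Type*} [MeasurableSpace X] (μ : Measure X)
    {x : X → Fin K → ℝ} (hx : Measurable x) {F : Equiv.Perm (Fin K) → X → ℝ≥0∞}
    (hF : ∀ π, Measurable (F π)) :
    ∫⁻ h, F (descendingOrder (x h)) h ∂μ =
      ∑ π, ∫⁻ h, {h | descendingOrder (x h) = π}.indicator (F π) h ∂μ := by
  rw [← lintegral_finsetSum _ fun π _ =>
    (hF π).indicator (measurableSet_descendingOrder_comp_eq hx π)]
  refine lintegral_congr fun h => ?_
  rw [Finset.sum_eq_single (descendingOrder (x h))]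
  · simp
  · intro π _ hπ
    simp [Ne.symm hπ]
  · simp

lemma norm_update_congr {h : Fin K → EuclideanSpace ℂ (Fin M)} {k : Fin K}
    {v w : EuclideanSpace ℂ (Fin M)} (hvw : ‖v‖ = ‖w‖) (l : Fin K) :
    ‖Function.update h k v l‖ = ‖Function.update h k w l‖ := by
  by_cases hl : l = k
  · subst hl; simpa using hvw
  · simp [hl]

/-- The norm of a selected channel and its angle to the span of selected channels of other ranks
contribute independent factors. -/
theorem lintegral_inv_nusChannels (hKsM : Ks ≤ M) (hK : Ks ≤ K) (τ : Equiv.Perm (Fin Ks))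
    (i : Fin Ks) :
    ∫⁻ h, (ENNReal.ofReal (‖nusChannels hK h (τ i)‖ ^ 2 *
        sinSqAngle (fun i => nusChannels hK h (τ i)) i))⁻¹
        ∂Measure.pi (fun _ : Fin K => complexGaussianVec M) =
      expInv (normOrderStatLaw M K (Fin.castLE hK (τ i).rev)) * expInv (sinSqAngleLaw M i) := by
  have hi : (i : ℕ) < M := i.2.trans_le hKsM
  let u : Equiv.Perm (Fin K) → Fin Ks → Fin K := fun π i => π (Fin.castLE hK (τ i).rev)
  have hu : ∀ π, Function.Injective (u π) := fun π =>
    π.injective.comp ((Fin.castLE_injective hK).comp (Fin.rev_injective.comp τ.injective))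
  let F : Equiv.Perm (Fin K) → (Fin K → EuclideanSpace ℂ (Fin M)) → ℝ≥0∞ := fun π h =>
    (ENNReal.ofReal (‖h (u π i)‖ ^ 2 * sinSqAngle (h ∘ u π) i))⁻¹
  let N : Equiv.Perm (Fin K) → (Fin K → EuclideanSpace ℂ (Fin M)) → ℝ≥0∞ := fun π h =>
    (ENNReal.ofReal (‖h (u π i)‖ ^ 2))⁻¹
  have hF : ∀ π, Measurable (F π) := fun π =>
    have h1 : Measurable fun h : Fin K → EuclideanSpace ℂ (Fin M) => sinSqAngle (h ∘ u π) i :=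
      (measurable_sinSqAngle i).comp (measurable_pi_lambda _ fun _ => measurable_pi_apply _)
    have h2 : Measurable fun h : Fin K → EuclideanSpace ℂ (Fin M) => ‖h (u π i)‖ ^ 2 := by fun_prop
    (h2.fun_mul h1).ennreal_ofReal.inv
  have hN : ∀ π, Measurable (N π) := fun π => by fun_prop
  have h1 := lintegral_descendingOrder (Measure.pi fun _ : Fin K => complexGaussianVec M)
    measurable_norms hF
  have h2 := lintegral_descendingOrder (Measure.pi fun _ : Fin K => complexGaussianVec M)
    measurable_norms hN
  have h3 : expInv (normOrderStatLaw M K (Fin.castLE hK (τ i).rev)) =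
      ∫⁻ h, N (descendingOrder fun k => ‖h k‖) h
        ∂Measure.pi (fun _ : Fin K => complexGaussianVec M) := by
    rw [expInv, normOrderStatLaw, lintegral_map (by fun_prop) (measurable_normOrderStat _)]
    simp_rw [descendingOrder_norm_sq]
    rfl
  rw [h3, h2, sinSqAngleLaw_eq hi, Finset.sum_mul]
  refine h1.trans (Finset.sum_congr rfl fun π _ => ?_)
  -- The weight is `N π` cut off to the event that `π` sorts the norms; it sees the vector `h (u π
  -- i)` only through its norm.
  rw [expInv, ← lintegral_mul_sin_sq hi (u π i) (f := u π ∘ Fin.castLE i.2.le)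
    ((hu π).comp (Fin.castLE_injective _)) (fun j => (hu π).ne (Fin.ne_of_lt j.2))
    ((hN π).indicator (measurableSet_descendingOrder_comp_eq measurable_norms π)) ?_ (by fun_prop)]
  · refine lintegral_congr fun h => ?_
    by_cases hh : h ∈ {h : Fin K → EuclideanSpace ℂ (Fin M) | descendingOrder (fun k => ‖h k‖) = π}
    · rw [Set.indicator_of_mem hh, Set.indicator_of_mem hh]
      simp only [F, N]
      rw [ENNReal.ofReal_mul (by positivity), ENNReal.mul_inv (by simp) (by simp), sinSqAngle_eq]
      rfl
    · rw [Set.indicator_of_notMem hh, Set.indicator_of_notMem hh, zero_mul]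
  · intro h v w hvw
    simp only [Set.indicator_apply, N, norm_update_congr hvw]
    have e : (Function.update h (u π i) v ∈ {h : Fin K → EuclideanSpace ℂ (Fin M) |
          descendingOrder (fun k => ‖h k‖) = π}) =
        (Function.update h (u π i) w ∈ {h : Fin K → EuclideanSpace ℂ (Fin M) |
          descendingOrder (fun k => ‖h k‖) = π}) := by
      simp only [Set.mem_ofPred_eq, norm_update_congr hvw]
    simp only [e]

/-! ### Distribution function of the norm order statistics. -/

section cdf

open Finset in
lemma card_filter_comp_perm (x : Fin K → ℝ) (π : Equiv.Perm (Fin K)) (a : ℝ) :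
    #{k | a < (x ∘ π) k} = #{k | a < x k} := by
  refine Finset.card_bij (fun k _ => π k) (by simp) (by simp) fun k hk => ⟨π.symm k, ?_⟩
  simpa using hk

open Finset in
-- Ranks start at `0`: the entry of rank `r` is at most `a` exactly when no more than `r` entries
-- exceed `a`.
lemma descendingOrder_apply_le_iff (x : Fin K → ℝ) (r : Fin K) (a : ℝ) :
    x (descendingOrder x r) ≤ a ↔ K - (r : ℕ) ≤ #{k | x k ≤ a} := by
  have h1 := Tuple.lt_card_gt_iff_apply_gt_of_antitone (j := r) (a := a)
    (antitone_comp_descendingOrder x)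
  have h2 := Finset.card_filter_add_card_filter_not (s := (univ : Finset (Fin K))) (fun k => x k ≤ a)
  simp only [not_le, Finset.card_univ, Fintype.card_fin] at h2
  rw [card_filter_comp_perm] at h1
  rw [← not_lt, ← Function.comp_apply (f := x), ← h1]
  have := r.2
  omega

lemma measureReal_pi_filter_eq {X : Type*} [MeasurableSpace X] (μ : Measure X)
    [IsProbabilityMeasure μ] {B : Set X} (hB : MeasurableSet B) [DecidablePred (· ∈ B)]
    (T : Finset (Fin K)) :
    (Measure.pi fun _ : Fin K => μ).real {h | Finset.univ.filter (fun k => h k ∈ B) = T} =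
      μ.real B ^ T.card * (1 - μ.real B) ^ (K - T.card) := by
  have e : {h : Fin K → X | Finset.univ.filter (fun k => h k ∈ B) = T} =
      Set.pi Set.univ fun k => if k ∈ T then B else Bᶜ := by
    ext h
    simp only [Set.mem_ofPred_eq, Finset.ext_iff, Finset.mem_filter, Finset.mem_univ, true_and,
      Set.mem_pi, Set.mem_univ, true_imp_iff]
    refine forall_congr' fun k => ?_
    split_ifs with hk <;> simp [hk]
  rw [e, measureReal_def, Measure.pi_pi, ENNReal.toReal_prod]
  have h2 : ∀ k, (μ (if k ∈ T then B else Bᶜ)).toReal =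
      if k ∈ T then μ.real B else 1 - μ.real B := by
    intro k
    split_ifs
    · rfl
    · exact probReal_compl_eq_one_sub hB
  simp_rw [h2]
  rw [Finset.prod_ite, Finset.prod_const, Finset.prod_const, Finset.filter_univ_mem,
    Finset.filter_not, Finset.filter_univ_mem, ← Finset.compl_eq_univ_sdiff, Finset.card_compl,
    Fintype.card_fin]

/-- The event is partitioned by the set `T` of users with squared norm at most `x`. By independence
its probability depends on `T.card` only, and grouping by cardinality gives the binomial
coefficients. -/
theorem cdf_normOrderStatLaw (hM : 0 < M) (r : Fin K) (x : ℝ) :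
    cdf (normOrderStatLaw M K r) x =
      ∑ j ∈ Finset.Icc (K - (r : ℕ)) K, (K.choose j : ℝ) *
        cdf (gammaMeasure M 1) x ^ j * (1 - cdf (gammaMeasure M 1) x) ^ (K - j) := by
  classical
  have := isProbabilityMeasure_gammaMeasure (a := M) (r := 1) (by exact_mod_cast hM) one_pos
  have hprob : IsProbabilityMeasure (normOrderStatLaw M K r) :=
    Measure.isProbabilityMeasure_map (measurable_normOrderStat r).aemeasurable
  let B : Set (EuclideanSpace ℂ (Fin M)) := {v | ‖v‖ ^ 2 ≤ x}
  have hB : MeasurableSet B := measurableSet_le (by fun_prop) measurable_const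
  have hG : cdf (gammaMeasure M 1) x = (complexGaussianVec M).real B := by
    rw [cdf_eq_real, ← map_norm_sq_complexGaussianVec hM,
      map_measureReal_apply (by fun_prop) measurableSet_Iic]
    rfl
  let Z : (Fin K → EuclideanSpace ℂ (Fin M)) → Finset (Fin K) :=
    fun h => Finset.univ.filter (fun k => h k ∈ B)
  have hZ : ∀ T, MeasurableSet {h | Z h = T} := by
    intro T
    have e : {h | Z h = T} = ⋂ k, {h | h k ∈ B ↔ k ∈ T} := by
      ext h; simp [Z, Finset.ext_iff]
    rw [e]
    refine MeasurableSet.iInter fun k => ?_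
    have hk : MeasurableSet {h : Fin K → EuclideanSpace ℂ (Fin M) | h k ∈ B} :=
      measurable_pi_apply k hB
    exact hk.iff (MeasurableSet.const _)
  let I := (Finset.univ : Finset (Finset (Fin K))).filter fun T => K - (r : ℕ) ≤ T.card
  have e : (fun h : Fin K → EuclideanSpace ℂ (Fin M) =>
      (fun k => ‖h k‖ ^ 2) (descendingOrder (fun k => ‖h k‖ ^ 2) r)) ⁻¹' Set.Iic x =
      ⋃ T ∈ I, {h | Z h = T} := by
    ext h
    simp only [Set.mem_preimage, Set.mem_Iic, Set.mem_iUnion, Set.mem_ofPred_eq, exists_prop,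
      exists_eq_right']
    rw [descendingOrder_apply_le_iff (fun k => ‖h k‖ ^ 2)]
    simp [I, Z, B]
  rw [cdf_eq_real, normOrderStatLaw,
    map_measureReal_apply (measurable_normOrderStat r) measurableSet_Iic, e,
    measureReal_biUnion_finset _ fun T _ => hZ T]
  · simp_rw [Z, measureReal_pi_filter_eq _ hB, ← hG]
    rw [← Finset.sum_fiberwise_of_maps_to (g := Finset.card) (t := Finset.Icc (K - (r : ℕ)) K)]
    · refine Finset.sum_congr rfl fun j hj => ?_
      have hIj : I.filter (fun T => T.card = j) = Finset.powersetCard j Finset.univ := by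
        ext T
        have := (Finset.mem_Icc.1 hj).1
        simp only [I, Finset.mem_filter, Finset.mem_univ, true_and, Finset.mem_powersetCard,
          Finset.subset_univ]
        omega
      rw [hIj, Finset.sum_congr rfl (g := fun _ => cdf (gammaMeasure M 1) x ^ j *
        (1 - cdf (gammaMeasure M 1) x) ^ (K - j)) (fun T hT => by
          rw [(Finset.mem_powersetCard.1 hT).2]), Finset.sum_const, Finset.card_powersetCard,
        Finset.card_univ, Fintype.card_fin, nsmul_eq_mul, mul_assoc]
    · intro T hT
      have := T.card_le_univ
      rw [Fintype.card_fin] at this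
      exact Finset.mem_Icc.2 ⟨(Finset.mem_filter.1 hT).2, this⟩
  · intro T _ T' _ hne
    refine Set.disjoint_left.2 fun h h1 h2 => hne ?_
    exact h1.symm.trans h2

end cdf

end

/-! ### Deterministic bounds on the minimum power. -/

section

variable {M n : ℕ}

lemma norm_sq_mul_sinSqAngle (g : Fin n → EuclideanSpace ℂ (Fin M)) (i : Fin n) :
    ‖g i‖ ^ 2 * sinSqAngle g i = ‖(interferenceSpan g i)ᗮ.starProjection (g i)‖ ^ 2 :=
  norm_sq_mul_sin_sq_subspaceAngle _ _

/-- Zero forcing: each beamformer is orthogonal to the preceding channels. -/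
lemma exists_zeroForcing {σ γ : ℝ} (hσ : 0 < σ) (hγ : 0 < γ)
    (g : Fin n → EuclideanSpace ℂ (Fin M)) (hg : ∀ i, ‖g i‖ ^ 2 * sinSqAngle g i ≠ 0) :
    ∃ (v : Fin n → EuclideanSpace ℂ (Fin M)) (p : Fin n → ℝ),
      (∀ i, ‖v i‖ = 1) ∧ (∀ i, 0 < p i) ∧ (∀ i, p i * ‖inner ℂ (g i) (v i)‖ ^ 2 = γ * σ ^ 2) ∧
      (∀ j k, j < k → inner ℂ (g j) (v k) = 0) ∧
      ∀ i, p i = σ ^ 2 * γ / (‖g i‖ ^ 2 * sinSqAngle g i) := by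
  -- The part of `g i` orthogonal to the earlier channels; its squared norm is the denominator of
  -- the high-SINR expression.
  let w : Fin n → EuclideanSpace ℂ (Fin M) :=
    fun i => (interferenceSpan g i)ᗮ.starProjection (g i)
  have hw : ∀ i, ‖w i‖ ≠ 0 := fun i h => hg i (by
    rw [norm_sq_mul_sinSqAngle]; simpa [w] using h)
  refine ⟨fun i => ((‖w i‖⁻¹ : ℝ) : ℂ) • w i, fun i => σ ^ 2 * γ / ‖w i‖ ^ 2, fun i => ?_,
    fun i => ?_, fun i => ?_, fun j k hjk => ?_, fun i => ?_⟩
  · simp [norm_smul, inv_mul_cancel₀ (hw i)]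
  · have := (norm_nonneg (w i)).lt_of_ne' (hw i)
    positivity
  · have h1 : inner ℂ (g i) (w i) = (‖w i‖ ^ 2 : ℂ) := by
      have h2 : inner ℂ (g i) (w i) = inner ℂ (w i) (w i) := by
        conv_rhs => rw [Submodule.inner_starProjection_left_eq_right]
        simp only [w]
        rw [Submodule.starProjection_eq_self_iff.2 (Submodule.starProjection_apply_mem _ _)]
      rw [h2, inner_self_eq_norm_sq_to_K]
      rfl
    rw [inner_smul_right, h1, norm_mul, norm_pow, Complex.norm_real, Complex.norm_real,
      norm_inv, norm_norm]
    have := hw i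
    field_simp
  · rw [inner_smul_right, Submodule.inner_right_of_mem_orthogonal (K := interferenceSpan g k)
      (Submodule.subset_span ⟨j, hjk, rfl⟩) (Submodule.starProjection_apply_mem _ _), mul_zero]
  · rw [norm_sq_mul_sinSqAngle]

/-- Both links interfere only through products of `g j` with `v k` for `j < k`, so the same
zero-forcing beamformers clear both. If a denominator vanishes, the right-hand side is `∞`. -/
lemma minPower_le_highSINRPower {σ γ : ℝ} (hσ : 0 < σ) (hγ : 0 < γ)
    (g : Fin n → EuclideanSpace ℂ (Fin M))
    (sinr : (Fin n → EuclideanSpace ℂ (Fin M)) → (Fin n → ℝ) → Fin n → ℝ)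
    (hsinr : ∀ v p, (∀ j k, j < k → inner ℂ (g j) (v k) = 0) → ∀ k,
      sinr v p k = p k * ‖inner ℂ (g k) (v k)‖ ^ 2 / σ ^ 2) :
    minPower sinr γ ≤ highSINRPower σ γ g := by
  by_cases hg : ∀ i, ‖g i‖ ^ 2 * sinSqAngle g i ≠ 0
  · obtain ⟨v, p, hv, hp, hpv, horth, hpe⟩ := exists_zeroForcing hσ hγ g hg
    refine iInf_le_of_le v (iInf_le_of_le p (iInf_le_of_le ⟨hv, hp, fun i => ?_⟩ ?_))
    · rw [hsinr v p horth, hpv, mul_div_cancel_right₀ _ (by positivity)]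
    · rw [ENNReal.ofReal_sum_of_nonneg fun i _ => (hp i).le, highSINRPower]
      refine Finset.sum_le_sum fun i _ => ?_
      have : 0 < ‖g i‖ ^ 2 * sinSqAngle g i :=
        lt_of_le_of_ne (by rw [norm_sq_mul_sinSqAngle]; positivity) (hg i).symm
      rw [hpe, ENNReal.ofReal_div_of_pos this]
  · push Not at hg
    obtain ⟨i, hi⟩ := hg
    rw [highSINRPower, ENNReal.sum_eq_top.2 ⟨i, Finset.mem_univ _, ?_⟩]
    · exact le_top
    · rw [hi, ENNReal.ofReal_zero, ENNReal.div_zero]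
      simp only [ne_eq, ENNReal.ofReal_eq_zero, not_le]
      positivity

lemma minPower_downlink_le {σ γ : ℝ} (hσ : 0 < σ) (hγ : 0 < γ)
    (g : Fin n → EuclideanSpace ℂ (Fin M)) :
    minPower (downlinkSINR σ g) γ ≤ highSINRPower σ γ g := by
  refine minPower_le_highSINRPower hσ hγ g _ fun v p h k => ?_
  rw [downlinkSINR, Finset.sum_eq_zero, zero_add]
  intro j hj
  simp [h k j (Finset.mem_filter.1 hj).2]

lemma minPower_uplink_le {σ γ : ℝ} (hσ : 0 < σ) (hγ : 0 < γ)
    (g : Fin n → EuclideanSpace ℂ (Fin M)) :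
    minPower (uplinkSINR σ g) γ ≤ highSINRPower σ γ g := by
  refine minPower_le_highSINRPower hσ hγ g _ fun v p h k => ?_
  rw [uplinkSINR, Finset.sum_eq_zero, zero_add]
  intro j hj
  simp [h j k (Finset.mem_filter.1 hj).2]

/-- By induction, `p j ≥ γσ² / q j` for all `j < k`. This bounds the interference met by user `k`
from below, and `hgq` converts it into the same bound for `p k`. -/
lemma uplink_power_le {σ γ : ℝ} (hσ : 0 < σ) (hγ : 0 < γ) {g v : Fin n → EuclideanSpace ℂ (Fin M)}
    {p q : Fin n → ℝ} (hv : ∀ i, ‖v i‖ = 1) (hp : ∀ i, 0 < p i)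
    (h : ∀ i, γ ≤ uplinkSINR σ g v p i) (hq : ∀ i, 0 < q i)
    (hgq : ∀ k (u : EuclideanSpace ℂ (Fin M)), ‖u‖ = 1 → ‖inner ℂ (g k) u‖ ^ 2 ≤
      q k * (1 + γ * ∑ j with j < k, ‖inner ℂ (g j) u‖ ^ 2 / q j)) :
    γ * σ ^ 2 * ∑ i, 1 / q i ≤ ∑ i, p i := by
  rw [Finset.mul_sum]
  refine Finset.sum_le_sum fun k _ => ?_
  induction k using WellFoundedLT.induction with
  | ind k ih =>
    have h0 : 0 ≤ ∑ j with j < k, p j * ‖inner ℂ (g j) (v k)‖ ^ 2 :=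
      Finset.sum_nonneg fun j _ => mul_nonneg (hp j).le (by positivity)
    have h1 := h k
    rw [uplinkSINR, le_div_iff₀ (by positivity)] at h1
    have h2 : σ ^ 2 * (γ * ∑ j with j < k, ‖inner ℂ (g j) (v k)‖ ^ 2 / q j) ≤
        ∑ j with j < k, p j * ‖inner ℂ (g j) (v k)‖ ^ 2 := by
      rw [Finset.mul_sum, Finset.mul_sum]
      refine Finset.sum_le_sum fun j hj => ?_
      have := mul_le_mul_of_nonneg_right (ih j (Finset.mem_filter.1 hj).2 (Finset.mem_univ _))
        (sq_nonneg ‖inner ℂ (g j) (v k)‖)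
      refine le_trans (le_of_eq ?_) this
      ring
    have h3 := hgq k (v k) (hv k)
    set A := ‖inner ℂ (g k) (v k)‖ ^ 2
    set D := γ * ∑ j with j < k, ‖inner ℂ (g j) (v k)‖ ^ 2 / q j
    have hA : 0 < A := by
      have : 0 < p k * A := lt_of_lt_of_le (by positivity) h1
      exact pos_of_mul_pos_right this (hp k).le
    have h4 : γ * σ ^ 2 * (1 + D) ≤ p k * A := by nlinarith
    rw [mul_one_div, div_le_iff₀ (hq k)]
    have h5 : γ * σ ^ 2 * A ≤ p k * q k * A := by
      have := mul_le_mul_of_nonneg_left h3 (show 0 ≤ γ * σ ^ 2 by positivity)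
      have := mul_le_mul_of_nonneg_left h4 (hq k).le
      nlinarith
    exact le_of_mul_le_mul_right h5 hA

/-- Weak duality: only the total is bounded, not the individual powers. The constraint of user `k`
is divided by `q k`; after summation the interference terms on the two sides are the same double sum
and cancel. -/
lemma downlink_power_le {σ γ : ℝ} (hσ : 0 < σ) (hγ : 0 < γ)
    {g v : Fin n → EuclideanSpace ℂ (Fin M)}
    {p q : Fin n → ℝ} (hv : ∀ i, ‖v i‖ = 1) (hp : ∀ i, 0 < p i)
    (h : ∀ i, γ ≤ downlinkSINR σ g v p i) (hq : ∀ i, 0 < q i)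
    (hgq : ∀ k (u : EuclideanSpace ℂ (Fin M)), ‖u‖ = 1 → ‖inner ℂ (g k) u‖ ^ 2 ≤
      q k * (1 + γ * ∑ j with j < k, ‖inner ℂ (g j) u‖ ^ 2 / q j)) :
    γ * σ ^ 2 * ∑ i, 1 / q i ≤ ∑ i, p i := by
  have h1 : ∀ k, γ / q k * (∑ j with k < j, p j * ‖inner ℂ (g k) (v j)‖ ^ 2) + γ * σ ^ 2 * (1 / q k) ≤
      p k + ∑ j with j < k, γ / q j * (p k * ‖inner ℂ (g j) (v k)‖ ^ 2) := by
    intro k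
    have h0 : 0 ≤ ∑ j with k < j, p j * ‖inner ℂ (g k) (v j)‖ ^ 2 :=
      Finset.sum_nonneg fun j _ => mul_nonneg (hp j).le (by positivity)
    have h2 := h k
    rw [downlinkSINR, le_div_iff₀ (by positivity)] at h2
    have h3 := mul_le_mul_of_nonneg_left (hgq k (v k) (hv k)) (hp k).le
    have h4 := h2.trans h3
    have h5 : p k + ∑ j with j < k, γ / q j * (p k * ‖inner ℂ (g j) (v k)‖ ^ 2) =
        p k * (1 + γ * ∑ j with j < k, ‖inner ℂ (g j) (v k)‖ ^ 2 / q j) := by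
      rw [mul_add, mul_one, Finset.mul_sum, Finset.mul_sum]
      congr 1
      refine Finset.sum_congr rfl fun j _ => by ring
    rw [h5]
    refine le_of_mul_le_mul_left (le_trans (le_of_eq ?_) (h4.trans (le_of_eq ?_))) (hq k)
    · have := (hq k).ne'
      field_simp
    · ring
  have h2 := Finset.sum_le_sum fun k (_ : k ∈ Finset.univ) => h1 k
  rw [Finset.sum_add_distrib, Finset.sum_add_distrib, ← Finset.mul_sum] at h2
  have h3 : ∑ k, γ / q k * (∑ j with k < j, p j * ‖inner ℂ (g k) (v j)‖ ^ 2) =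
      ∑ k, ∑ j with j < k, γ / q j * (p k * ‖inner ℂ (g j) (v k)‖ ^ 2) := by
    simp_rw [Finset.mul_sum, Finset.sum_filter]
    exact Finset.sum_comm
  rw [h3] at h2
  linarith

/-- The best signal-to-interference gain of the `k`-th channel over unit-norm beamformers, when
each preceding channel `g j` interferes with power `γ / (1 + ‖g j‖²)`. -/
noncomputable def regularizedGain (γ : ℝ) (g : Fin n → EuclideanSpace ℂ (Fin M)) (k : Fin n) :
    ℝ≥0∞ :=
  ⨆ u : Metric.sphere (0 : EuclideanSpace ℂ (Fin M)) 1,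
    ENNReal.ofReal (‖inner ℂ (g k) u.1‖ ^ 2 /
      (1 + γ * ∑ j with j < k, ‖inner ℂ (g j) u.1‖ ^ 2 / (1 + ‖g j‖ ^ 2)))

lemma regularizedGain_denom_pos {γ : ℝ} (hγ : 0 ≤ γ) (g : Fin n → EuclideanSpace ℂ (Fin M))
    (k : Fin n) (u : EuclideanSpace ℂ (Fin M)) :
    1 ≤ 1 + γ * ∑ j with j < k, ‖inner ℂ (g j) u‖ ^ 2 / (1 + ‖g j‖ ^ 2) :=
  le_add_of_nonneg_right (mul_nonneg hγ (Finset.sum_nonneg fun j _ => by positivity))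

/-- An uncountable supremum, but of functions continuous in `g`, hence lower semicontinuous. The
summand `1` in `1 + ‖g j‖²` keeps the quotients continuous at zero channels. -/
lemma measurable_regularizedGain {γ : ℝ} (hγ : 0 ≤ γ) (k : Fin n) :
    Measurable fun g : Fin n → EuclideanSpace ℂ (Fin M) => regularizedGain γ g k := by
  refine LowerSemicontinuous.measurable (lowerSemicontinuous_iSup fun u => ?_)
  refine Continuous.lowerSemicontinuous (ENNReal.continuous_ofReal.comp ?_)
  refine Continuous.div (by fun_prop) ?_ fun g =>
    (zero_lt_one.trans_le (regularizedGain_denom_pos hγ g k u)).ne'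
  refine continuous_const.add (continuous_const.mul (continuous_finsetSum _ fun j _ => ?_))
  exact Continuous.div (by fun_prop) (by fun_prop) fun g => by positivity

lemma regularizedGain_antitone {γ γ' : ℝ} (hγ : 0 ≤ γ) (hγγ' : γ ≤ γ')
    (g : Fin n → EuclideanSpace ℂ (Fin M)) (k : Fin n) :
    regularizedGain γ' g k ≤ regularizedGain γ g k := by
  refine iSup_mono fun u => ENNReal.ofReal_le_ofReal ?_
  have h := regularizedGain_denom_pos hγ g k u.1
  refine div_le_div_of_nonneg_left (by positivity) (by linarith) ?_
  gcongr

lemma regularizedGain_le {γ : ℝ} (hγ : 0 ≤ γ) (g : Fin n → EuclideanSpace ℂ (Fin M)) (k : Fin n) :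
    regularizedGain γ g k ≤ ENNReal.ofReal (‖g k‖ ^ 2) := by
  refine iSup_le fun u => ENNReal.ofReal_le_ofReal ?_
  have h := regularizedGain_denom_pos hγ g k u.1
  refine (div_le_self (by positivity) h).trans ?_
  have h1 := norm_inner_le_norm (𝕜 := ℂ) (g k) u.1
  rw [norm_eq_of_mem_sphere u, mul_one] at h1
  gcongr

lemma regularizedGain_pos {γ : ℝ} (hγ : 0 ≤ γ) {g : Fin n → EuclideanSpace ℂ (Fin M)} {k : Fin n}
    (hg : g k ≠ 0) : 0 < regularizedGain γ g k := by
  have hn : ‖g k‖ ≠ 0 := norm_ne_zero_iff.2 hg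
  let u : EuclideanSpace ℂ (Fin M) := ((‖g k‖⁻¹ : ℝ) : ℂ) • g k
  have hu : u ∈ Metric.sphere (0 : EuclideanSpace ℂ (Fin M)) 1 := by
    simp [u, norm_smul, inv_mul_cancel₀ hn]
  refine lt_of_lt_of_le (ENNReal.ofReal_pos.2 ?_)
    (le_iSup (fun u : Metric.sphere (0 : EuclideanSpace ℂ (Fin M)) 1 =>
      ENNReal.ofReal (‖inner ℂ (g k) u.1‖ ^ 2 /
        (1 + γ * ∑ j with j < k, ‖inner ℂ (g j) u.1‖ ^ 2 / (1 + ‖g j‖ ^ 2)))) ⟨u, hu⟩)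
  refine div_pos ?_ (zero_lt_one.trans_le (regularizedGain_denom_pos hγ g k u))
  have h1 : inner ℂ (g k) u ≠ 0 := by
    rw [inner_smul_right]
    simp [hg]
  positivity

lemma le_regularizedGain_toReal {γ : ℝ} (hγ : 0 ≤ γ) (g : Fin n → EuclideanSpace ℂ (Fin M))
    (k : Fin n) {u : EuclideanSpace ℂ (Fin M)} (hu : ‖u‖ = 1) :
    ‖inner ℂ (g k) u‖ ^ 2 ≤ (regularizedGain γ g k).toReal *
      (1 + γ * ∑ j with j < k, ‖inner ℂ (g j) u‖ ^ 2 / (1 + ‖g j‖ ^ 2)) := by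
  rw [← div_le_iff₀ (zero_lt_one.trans_le (regularizedGain_denom_pos hγ g k u)),
    ← ENNReal.ofReal_le_iff_le_toReal
      ((regularizedGain_le hγ g k).trans_lt ENNReal.ofReal_lt_top).ne]
  exact le_iSup (fun u : Metric.sphere (0 : EuclideanSpace ℂ (Fin M)) 1 =>
      ENNReal.ofReal (‖inner ℂ (g k) u.1‖ ^ 2 /
        (1 + γ * ∑ j with j < k, ‖inner ℂ (g j) u.1‖ ^ 2 / (1 + ‖g j‖ ^ 2))))
      ⟨u, by simpa using hu⟩

/-- The gains serve as `q`: since `q j ≤ 1 + ‖g j‖²`, putting `q j` in the denominators only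
enlarges the interference term, so the inequality required by `hpow` persists. Feasibility excludes
zero channels (`hsinr`) and makes every `q j` positive. -/
lemma ofReal_mul_sum_inv_regularizedGain_le {σ γ : ℝ} (hσ : 0 < σ) (hγ : 0 < γ)
    {g : Fin n → EuclideanSpace ℂ (Fin M)}
    {sinr : (Fin n → EuclideanSpace ℂ (Fin M)) → (Fin n → ℝ) → Fin n → ℝ}
    (hsinr : ∀ v p k, g k = 0 → sinr v p k = 0)
    (hpow : ∀ v p, (∀ i, ‖v i‖ = 1) → (∀ i, 0 < p i) → (∀ i, γ ≤ sinr v p i) →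
      ∀ q : Fin n → ℝ, (∀ i, 0 < q i) →
      (∀ k (u : EuclideanSpace ℂ (Fin M)), ‖u‖ = 1 → ‖inner ℂ (g k) u‖ ^ 2 ≤
        q k * (1 + γ * ∑ j with j < k, ‖inner ℂ (g j) u‖ ^ 2 / q j)) →
      γ * σ ^ 2 * ∑ i, 1 / q i ≤ ∑ i, p i) :
    ENNReal.ofReal (σ ^ 2 * γ) * ∑ k, (regularizedGain γ g k)⁻¹ ≤ minPower sinr γ := by
  refine le_iInf fun v => le_iInf fun p => le_iInf fun ⟨hv, hp, h⟩ => ?_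
  have hg : ∀ k, g k ≠ 0 := fun k hk => by
    have := h k
    rw [hsinr v p k hk] at this
    linarith
  let q : Fin n → ℝ := fun k => (regularizedGain γ g k).toReal
  have hfin : ∀ k, regularizedGain γ g k ≠ ∞ := fun k =>
    ((regularizedGain_le hγ.le g k).trans_lt ENNReal.ofReal_lt_top).ne
  have hq : ∀ k, 0 < q k := fun k =>
    ENNReal.toReal_pos (regularizedGain_pos hγ.le (hg k)).ne' (hfin k)
  have hq1 : ∀ k, q k ≤ 1 + ‖g k‖ ^ 2 := fun k =>
    (ENNReal.toReal_le_of_le_ofReal (by positivity) (regularizedGain_le hγ.le g k)).trans (by simp)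
  have key := hpow v p hv hp h q hq fun k u hu => by
    refine (le_regularizedGain_toReal hγ.le g k hu).trans ?_
    refine mul_le_mul_of_nonneg_left ?_ (hq k).le
    gcongr with j hj
    · exact hq j
    · exact hq1 j
  refine le_trans (le_of_eq ?_) (ENNReal.ofReal_le_ofReal key)
  have h1 : ∀ k, (regularizedGain γ g k)⁻¹ = ENNReal.ofReal (1 / q k) := fun k => by
    rw [one_div, ENNReal.ofReal_inv_of_pos (hq k), ENNReal.ofReal_toReal (hfin k)]
  simp_rw [h1]
  rw [← ENNReal.ofReal_sum_of_nonneg fun k _ => (one_div_pos.2 (hq k)).le,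
    ← ENNReal.ofReal_mul (by positivity), mul_comm (σ ^ 2)]

lemma le_minPower_downlink {σ γ : ℝ} (hσ : 0 < σ) (hγ : 0 < γ)
    (g : Fin n → EuclideanSpace ℂ (Fin M)) :
    ENNReal.ofReal (σ ^ 2 * γ) * ∑ k, (regularizedGain γ g k)⁻¹ ≤
      minPower (downlinkSINR σ g) γ :=
  ofReal_mul_sum_inv_regularizedGain_le hσ hγ (fun v p k hk => by simp [downlinkSINR, hk])
    fun _ _ hv hp h _ hq hgq => downlink_power_le hσ hγ hv hp h hq hgq

lemma le_minPower_uplink {σ γ : ℝ} (hσ : 0 < σ) (hγ : 0 < γ)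
    (g : Fin n → EuclideanSpace ℂ (Fin M)) :
    ENNReal.ofReal (σ ^ 2 * γ) * ∑ k, (regularizedGain γ g k)⁻¹ ≤
      minPower (uplinkSINR σ g) γ :=
  ofReal_mul_sum_inv_regularizedGain_le hσ hγ (fun v p k hk => by simp [uplinkSINR, hk])
    fun _ _ hv hp h _ hq hgq => uplink_power_le hσ hγ hv hp h hq hgq

end

/-! ### The large-target limit of the gains and of the averages. -/

section

variable {M K Ks n : ℕ}

/-- Write `g k` as `w` plus a combination of earlier channels. A direction that profits from the
second part also collects interference, at a price growing with `γ`. The constant depends on the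
coefficients `a j`, not on `u` or `γ`. -/
lemma exists_regularizedGain_le (g : Fin n → EuclideanSpace ℂ (Fin M)) (k : Fin n) :
    ∃ C : ℝ, ∀ γ : ℝ, 0 < γ →
      regularizedGain γ g k ≤ ENNReal.ofReal (‖g k‖ ^ 2 * sinSqAngle g k + C / γ) := by
  set S := interferenceSpan g k
  have hmem : S.starProjection (g k) ∈ Submodule.span ℂ
      (g '' ((Finset.univ.filter fun j => j < k : Finset (Fin n)) : Set (Fin n))) := by
    have := S.starProjection_apply_mem (g k)
    simpa only [S, interferenceSpan, Finset.coe_filter, Finset.mem_univ, true_and] using this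
  obtain ⟨a, ha⟩ := (Submodule.mem_span_image_finset_iff_exists_fun' ℂ).1 hmem
  set w := Sᗮ.starProjection (g k)
  have hgk : g k = w + ∑ j with j < k, a j • g j := by
    rw [ha, add_comm, S.starProjection_add_starProjection_orthogonal]
  set C := ∑ j with j < k, ‖a j‖ ^ 2 * (1 + ‖g j‖ ^ 2)
  have hC : 0 ≤ C := Finset.sum_nonneg fun j _ => by positivity
  refine ⟨C, fun γ hγ => iSup_le fun u => ENNReal.ofReal_le_ofReal ?_⟩
  rw [norm_sq_mul_sinSqAngle, div_le_iff₀ (zero_lt_one.trans_le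
    (regularizedGain_denom_pos hγ.le g k u.1))]
  set D := ∑ j with j < k, ‖inner ℂ (g j) u.1‖ ^ 2 / (1 + ‖g j‖ ^ 2)
  have hD : 0 ≤ D := Finset.sum_nonneg fun j _ => by positivity
  set B := ∑ j with j < k, ‖a j‖ * ‖inner ℂ (g j) u.1‖
  have hB : 0 ≤ B := Finset.sum_nonneg fun j _ => by positivity
  have hBCD : B ^ 2 ≤ C * D := by
    refine Finset.sum_sq_le_sum_mul_sum_of_sq_le_mul _ (fun j _ => by positivity)
      (fun j _ => by positivity) fun j _ => ?_
    have : (1 + ‖g j‖ ^ 2) ≠ 0 := by positivity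
    refine le_of_eq ?_
    field_simp
  have h1 : ‖inner ℂ (g k) u.1‖ ≤ ‖w‖ + B := by
    rw [hgk, inner_add_left, sum_inner]
    refine (norm_add_le _ _).trans (add_le_add ?_ ?_)
    · have := norm_inner_le_norm (𝕜 := ℂ) w u.1
      rwa [norm_eq_of_mem_sphere u, mul_one] at this
    · refine (norm_sum_le _ _).trans (Finset.sum_le_sum fun j _ => ?_)
      rw [inner_smul_left, norm_mul, RCLike.norm_conj]
  -- AM–GM on the two right-hand terms, whose product is `‖w‖² C D ≥ ‖w‖² B²`.
  have h2 : 2 * ‖w‖ * B ≤ ‖w‖ ^ 2 * (γ * D) + C / γ := by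
    have hCγ : 0 ≤ C / γ := div_nonneg hC hγ.le
    refine (sq_le_sq₀ (by positivity) (by positivity)).1 ?_
    have e : C * D = C / γ * (γ * D) := by field_simp
    rw [e] at hBCD
    nlinarith [sq_nonneg (‖w‖ ^ 2 * (γ * D) - C / γ),
      mul_le_mul_of_nonneg_left hBCD (sq_nonneg ‖w‖)]
  calc ‖inner ℂ (g k) u.1‖ ^ 2 ≤ (‖w‖ + B) ^ 2 := by gcongr
    _ = ‖w‖ ^ 2 + 2 * ‖w‖ * B + B ^ 2 := by ring
    _ ≤ ‖w‖ ^ 2 + (‖w‖ ^ 2 * (γ * D) + C / γ) + C * D := by gcongr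
    _ = (‖w‖ ^ 2 + C / γ) * (1 + γ * D) := by field_simp; ring

lemma inv_le_iSup_inv_regularizedGain (g : Fin n → EuclideanSpace ℂ (Fin M)) (k : Fin n) :
    (ENNReal.ofReal (‖g k‖ ^ 2 * sinSqAngle g k))⁻¹ ≤ ⨆ m : ℕ, (regularizedGain (m : ℝ) g k)⁻¹ := by
  obtain ⟨C, hC⟩ := exists_regularizedGain_le g k
  have h1 : Tendsto (fun m : ℕ => ‖g k‖ ^ 2 * sinSqAngle g k + C / ((m : ℝ) + 1)) atTop
      (𝓝 (‖g k‖ ^ 2 * sinSqAngle g k + 0)) :=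
    tendsto_const_nhds.add (by
      simpa [div_eq_mul_inv] using (tendsto_one_div_add_atTop_nhds_zero_nat (𝕜 := ℝ)).const_mul C)
  rw [add_zero] at h1
  have h2 := tendsto_inv_iff.2 (ENNReal.tendsto_ofReal h1)
  refine le_of_tendsto' h2 fun m => ?_
  refine le_trans ?_ (le_iSup (fun m : ℕ => (regularizedGain (m : ℝ) g k)⁻¹) (m + 1))
  have := hC (m + 1) (by positivity)
  rw [ENNReal.inv_le_inv]
  exact_mod_cast this

lemma monotone_inv_regularizedGain (g : Fin n → EuclideanSpace ℂ (Fin M)) (k : Fin n) :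
    Monotone fun m : ℕ => (regularizedGain (m : ℝ) g k)⁻¹ := fun m m' h =>
  ENNReal.inv_le_inv.2 (regularizedGain_antitone (by positivity) (by exact_mod_cast h) g k)

lemma highSINRPower_eq (σ γ : ℝ) (g : Fin n → EuclideanSpace ℂ (Fin M)) :
    highSINRPower σ γ g = ENNReal.ofReal (σ ^ 2 * γ) *
      ∑ i, (ENNReal.ofReal (‖g i‖ ^ 2 * sinSqAngle g i))⁻¹ := by
  rw [Finset.mul_sum]
  rfl

lemma measurable_inv_norm_sq_mul_sinSqAngle (i : Fin n) :
    Measurable fun g : Fin n → EuclideanSpace ℂ (Fin M) =>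
      (ENNReal.ofReal (‖g i‖ ^ 2 * sinSqAngle g i))⁻¹ := by
  have := measurable_sinSqAngle (M := M) i
  fun_prop

lemma measurable_highSINRPower (σ γ : ℝ) :
    Measurable fun g : Fin n → EuclideanSpace ℂ (Fin M) => highSINRPower σ γ g := by
  simp_rw [highSINRPower_eq]
  exact (Finset.measurable_sum _ fun i _ => measurable_inv_norm_sq_mul_sinSqAngle i).const_mul _

lemma measurable_inv_nusChannels (hK : Ks ≤ K) (τ : Equiv.Perm (Fin Ks)) (i : Fin Ks) :
    Measurable fun h : Fin K → EuclideanSpace ℂ (Fin M) =>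
      (ENNReal.ofReal (‖nusChannels hK h (τ i)‖ ^ 2 *
        sinSqAngle (fun i => nusChannels hK h (τ i)) i))⁻¹ := by
  have hm : Measurable fun (h : Fin K → EuclideanSpace ℂ (Fin M)) i => nusChannels hK h (τ i) :=
    measurable_pi_lambda _ fun i => measurable_pi_iff.1 (measurable_nusChannels hK) (τ i)
  have h := (measurable_inv_norm_sq_mul_sinSqAngle i).comp hm
  exact h

theorem lintegral_highSINRPower (hKsM : Ks ≤ M) (hK : Ks ≤ K) (σ γ : ℝ)
    (τ : Equiv.Perm (Fin Ks)) :
    ∫⁻ h, highSINRPower σ γ (fun i => nusChannels hK h (τ i))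
        ∂Measure.pi (fun _ : Fin K => complexGaussianVec M) =
      ENNReal.ofReal (σ ^ 2 * γ) * ∑ i, expInv (normOrderStatLaw M K (Fin.castLE hK (τ i).rev)) *
        expInv (sinSqAngleLaw M i) := by
  rw [← Finset.sum_congr rfl fun i _ => lintegral_inv_nusChannels hKsM hK τ i,
    ← lintegral_finsetSum _ fun i _ => measurable_inv_nusChannels hK τ i,
    ← lintegral_const_mul _ (Finset.measurable_sum _ fun i _ => measurable_inv_nusChannels hK τ i)]
  exact lintegral_congr fun h => highSINRPower_eq σ γ _

lemma lintegral_highSINRPower_nusChannels (hKsM : Ks ≤ M) (hK : Ks ≤ K) (σ γ : ℝ) :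
    ∫⁻ h, highSINRPower σ γ (nusChannels hK h)
        ∂Measure.pi (fun _ : Fin K => complexGaussianVec M) =
      ENNReal.ofReal (σ ^ 2 * γ) * nusSum M hK :=
  lintegral_highSINRPower hKsM hK σ γ 1

/-- The law of the channel matrix is the product law. -/
lemma hasLaw_channels {Ω : Type*} [MeasurableSpace Ω] {P : Measure Ω}
    [IsProbabilityMeasure P] {H : Fin K → Ω → EuclideanSpace ℂ (Fin M)}
    (hindep : iIndepFun (fun (km : Fin K × Fin M) (ω : Ω) => H km.1 ω km.2) P)
    (hlaw : ∀ k m, HasLaw (fun ω => H k ω m) stdComplexGaussian P) :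
    HasLaw (fun ω k => H k ω) (Measure.pi fun _ : Fin K => complexGaussianVec M) P := by
  have h1 := (iIndepFun_iff_map_fun_eq_pi_map
    (fun km : Fin K × Fin M => (hlaw km.1 km.2).aemeasurable)).1 hindep
  simp_rw [(hlaw _ _).map_eq] at h1
  have hae : AEMeasurable (fun ω (km : Fin K × Fin M) => H km.1 ω km.2) P :=
    aemeasurable_pi_lambda _ fun km => (hlaw km.1 km.2).aemeasurable
  have h2 := Measure.infinitePi_map_curry (fun (_ : Fin K) (_ : Fin M) => stdComplexGaussian)
  simp_rw [Measure.infinitePi_eq_pi] at h2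
  have h3 := Measure.pi_map_pi (μ := fun _ : Fin K => Measure.pi fun _ : Fin M => stdComplexGaussian)
    (f := fun _ => WithLp.toLp 2) (fun _ => by fun_prop)
  have hm : Measurable fun (z : Fin K → Fin M → ℂ) k => WithLp.toLp 2 (z k) := by fun_prop
  have e : (fun ω k => H k ω) = ((fun (z : Fin K → Fin M → ℂ) k => WithLp.toLp 2 (z k)) ∘
      MeasurableEquiv.curry (Fin K) (Fin M) ℂ) ∘ fun ω (km : Fin K × Fin M) => H km.1 ω km.2 := rfl
  have hm' := hm.comp (MeasurableEquiv.curry (Fin K) (Fin M) ℂ).measurable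
  refine ⟨?_, ?_⟩
  · rw [e]
    exact hm'.comp_aemeasurable hae
  · rw [e, ← AEMeasurable.map_map_of_aemeasurable hm'.aemeasurable hae, h1,
      ← Measure.map_map hm (MeasurableEquiv.measurable _), h2, h3]
    rfl

/-- A quantity between the regularized bound and the high-SINR expression has the asymptotic
average of the latter. -/
theorem tendsto_lintegral_div {Ω : Type*} [MeasurableSpace Ω] {P : Measure Ω}
    (hKsM : Ks ≤ M) (hK : Ks ≤ K) {σ : ℝ} (hσ : 0 < σ)
    {X : Ω → Fin K → EuclideanSpace ℂ (Fin M)}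
    (hX : HasLaw X (Measure.pi fun _ : Fin K => complexGaussianVec M) P)
    {q : (Fin Ks → EuclideanSpace ℂ (Fin M)) → ℝ → ℝ≥0∞}
    (hlow : ∀ g γ, 0 < γ → ENNReal.ofReal (σ ^ 2 * γ) * ∑ k, (regularizedGain γ g k)⁻¹ ≤ q g γ)
    (hup : ∀ g γ, 0 < γ → q g γ ≤ highSINRPower σ γ g) :
    Tendsto (fun γ : ℝ => (∫⁻ ω, q (nusChannels hK (X ω)) γ ∂P) / ENNReal.ofReal γ)
      atTop (𝓝 (ENNReal.ofReal (σ ^ 2) * nusSum M hK)) := by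
  set μ := Measure.pi fun _ : Fin K => complexGaussianVec M
  have hmeas : ∀ (m : ℕ) (k : Fin Ks), Measurable fun h : Fin K → EuclideanSpace ℂ (Fin M) =>
      (regularizedGain (m : ℝ) (nusChannels hK h) k)⁻¹ := fun m k =>
    ((measurable_regularizedGain m.cast_nonneg k).comp (measurable_nusChannels hK)).inv
  have hmeasL : ∀ m : ℕ, Measurable fun h : Fin K → EuclideanSpace ℂ (Fin M) =>
      ∑ k, (regularizedGain (m : ℝ) (nusChannels hK h) k)⁻¹ := fun m =>
    Finset.measurable_sum _ fun k _ => hmeas m k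
  let J : ℕ → ℝ≥0∞ := fun m => ∫⁻ h, ∑ k, (regularizedGain (m : ℝ) (nusChannels hK h) k)⁻¹ ∂μ
  have hmono : Monotone fun (m : ℕ) (h : Fin K → EuclideanSpace ℂ (Fin M)) =>
      ∑ k, (regularizedGain (m : ℝ) (nusChannels hK h) k)⁻¹ := fun m m' hm h =>
    Finset.sum_le_sum fun k _ => monotone_inv_regularizedGain _ k hm
  have hJ : Monotone J := fun m m' hm => lintegral_mono (hmono hm)
  -- Monotone convergence; taking `σ = γ = 1` removes the prefactor. No finiteness is needed.
  have hS : nusSum M hK ≤ ⨆ m, J m := by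
    have h1 := lintegral_highSINRPower_nusChannels (M := M) hKsM hK 1 1
    rw [show ENNReal.ofReal (1 ^ 2 * 1) = 1 by simp, one_mul] at h1
    rw [← h1, ← lintegral_iSup hmeasL hmono]
    refine lintegral_mono fun h => ?_
    rw [highSINRPower_eq, show ENNReal.ofReal (1 ^ 2 * 1) = 1 by simp, one_mul,
      ← ENNReal.finsetSum_iSup_of_monotone fun k => monotone_inv_regularizedGain _ k]
    exact Finset.sum_le_sum fun k _ => inv_le_iSup_inv_regularizedGain _ k
  have hT : Tendsto (fun γ : ℝ => ENNReal.ofReal (σ ^ 2) * J ⌊γ⌋₊) atTop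
      (𝓝 (ENNReal.ofReal (σ ^ 2) * ⨆ m, J m)) :=
    ENNReal.Tendsto.const_mul ((tendsto_atTop_iSup hJ).comp tendsto_nat_floor_atTop)
      (Or.inr ENNReal.ofReal_ne_top)
  -- Antitonicity of the gain allows `γ` to be replaced by its floor. Measurability of `q` is never
  -- used: only the two bounding functions are transferred through the law of `X`.
  have hlo : ∀ᶠ γ : ℝ in atTop, ENNReal.ofReal (σ ^ 2) * J ⌊γ⌋₊ ≤
      (∫⁻ ω, q (nusChannels hK (X ω)) γ ∂P) / ENNReal.ofReal γ := by
    filter_upwards [eventually_gt_atTop 0] with γ hγ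
    rw [ENNReal.le_div_iff_mul_le (Or.inl (by simpa using hγ)) (Or.inl ENNReal.ofReal_ne_top),
      mul_right_comm, ← ENNReal.ofReal_mul (by positivity)]
    simp only [J]
    rw [← hX.lintegral_comp (hmeasL _).aemeasurable, ← lintegral_const_mul' _ _ ENNReal.ofReal_ne_top]
    refine lintegral_mono fun ω => le_trans ?_ (hlow _ γ hγ)
    refine mul_le_mul_right (Finset.sum_le_sum fun k _ => ENNReal.inv_le_inv.2 ?_) _
    exact regularizedGain_antitone (by positivity) (Nat.floor_le hγ.le) _ k
  have hhi : ∀ᶠ γ : ℝ in atTop, (∫⁻ ω, q (nusChannels hK (X ω)) γ ∂P) / ENNReal.ofReal γ ≤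
      ENNReal.ofReal (σ ^ 2) * nusSum M hK := by
    filter_upwards [eventually_gt_atTop 0] with γ hγ
    refine ENNReal.div_le_of_le_mul ?_
    rw [mul_right_comm, ← ENNReal.ofReal_mul (by positivity),
      ← lintegral_highSINRPower_nusChannels hKsM hK, ← hX.lintegral_comp
      (f := fun h => highSINRPower σ γ (nusChannels hK h))
      ((measurable_highSINRPower σ γ).comp (measurable_nusChannels hK)).aemeasurable]
    exact lintegral_mono fun ω => hup _ γ hγ
  -- The missing inequality comes from the squeeze itself: the lower bounds stay below the upper
  -- one, so their limit does too.
  have heq : ENNReal.ofReal (σ ^ 2) * ⨆ m, J m = ENNReal.ofReal (σ ^ 2) * nusSum M hK := by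
    refine le_antisymm (le_of_tendsto hT ?_) (mul_le_mul_right hS _)
    filter_upwards [hlo, hhi] with γ h1 h2 using h1.trans h2
  rw [heq] at hT
  exact tendsto_of_tendsto_of_tendsto_of_le_of_le' hT tendsto_const_nhds hlo hhi

end

/-! ### Finiteness of the sum and optimality of the ordering. -/

section

variable {M K Ks : ℕ}

/-- The integrand vanishes nowhere. Nonzero factors are what make a product with `∞` infinite in the
rearrangement argument. -/
lemma expInv_pos (ν : Measure ℝ) [NeZero ν] : expInv ν ≠ 0 := by
  rw [expInv, ne_eq, lintegral_eq_zero_iff (by fun_prop)]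
  intro h
  have h2 : ∀ᵐ _ ∂ν, False := by
    filter_upwards [h] with x hx
    simp at hx
  simp at h2
  exact NeZero.ne ν h2

/-- Dividing the density by `x` gives a multiple of the Gamma density of shape `a - 1`; the Beta
case below is analogous. -/
lemma expInv_gammaMeasure_lt_top {a : ℝ} (ha : 1 < a) : expInv (gammaMeasure a 1) < ∞ := by
  have ha' : 0 < a - 1 := by linarith
  have hm := measurable_gammaPDF a 1
  rw [expInv, gammaMeasure, lintegral_withDensity_eq_lintegral_mul _ hm (by fun_prop)]
  have e : ∀ᵐ x : ℝ, (gammaPDF a 1 * fun x => (ENNReal.ofReal x)⁻¹) x =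
      ENNReal.ofReal (1 / (a - 1)) * gammaPDF (a - 1) 1 x := by
    filter_upwards [compl_mem_ae_iff.2 (measure_singleton (0 : ℝ))] with x hx
    rw [Pi.mul_apply]
    rcases lt_or_gt_of_ne (show x ≠ 0 from hx) with h | h
    · simp [gammaPDF_of_neg h]
    · have hG := Real.Gamma_pos_of_pos ha'
      rw [gammaPDF_of_nonneg h.le, gammaPDF_of_nonneg h.le, ← ENNReal.ofReal_inv_of_pos h,
        ← ENNReal.ofReal_mul' (by positivity), ← ENNReal.ofReal_mul (by positivity)]
      congr 1
      have h1 : Real.Gamma a = (a - 1) * Real.Gamma (a - 1) := by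
        rw [← Real.Gamma_add_one ha'.ne', sub_add_cancel]
      rw [h1, Real.rpow_sub_one h.ne' (a - 1)]
      simp only [Real.one_rpow]
      field_simp
  rw [lintegral_congr_ae e, lintegral_const_mul _ (measurable_gammaPDF _ _),
    lintegral_gammaPDF_eq_one ha' one_pos, mul_one]
  exact ENNReal.ofReal_lt_top

lemma expInv_betaMeasure_lt_top {a b : ℝ} (ha : 1 < a) (hb : 0 < b) :
    expInv (betaMeasure a b) < ∞ := by
  have ha' : 0 < a - 1 := by linarith
  rw [expInv, betaMeasure,
    lintegral_withDensity_eq_lintegral_mul _ (measurable_betaPDF a b) (by fun_prop)]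
  have hB := beta_pos (show 0 < a by linarith) hb
  have hB' := beta_pos ha' hb
  have e : ∀ x : ℝ, (betaPDF a b * fun x => (ENNReal.ofReal x)⁻¹) x =
      ENNReal.ofReal (beta (a - 1) b / beta a b) * betaPDF (a - 1) b x := by
    intro x
    rw [Pi.mul_apply]
    rcases le_or_gt x 0 with h | h
    · simp [betaPDF_eq_zero_of_nonpos h]
    rcases le_or_gt 1 x with h1 | h1
    · simp [betaPDF_eq_zero_of_one_le h1]
    rw [betaPDF_of_pos_lt_one h h1, betaPDF_of_pos_lt_one h h1, ← ENNReal.ofReal_inv_of_pos h,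
      ← ENNReal.ofReal_mul' (by positivity), ← ENNReal.ofReal_mul (by positivity)]
    congr 1
    rw [Real.rpow_sub_one h.ne' (a - 1)]
    field_simp
  rw [lintegral_congr e, lintegral_const_mul _ (measurable_betaPDF _ _),
    lintegral_betaPDF_eq_one ha' hb, mul_one]
  exact ENNReal.ofReal_lt_top

lemma expInv_normOrderStatLaw (r : Fin K) :
    expInv (normOrderStatLaw M K r) =
      ∫⁻ h, (ENNReal.ofReal ((fun k => ‖h k‖ ^ 2) (descendingOrder (fun k => ‖h k‖ ^ 2) r)))⁻¹
        ∂Measure.pi (fun _ : Fin K => complexGaussianVec M) := by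
  rw [expInv, normOrderStatLaw, lintegral_map (by fun_prop) (measurable_normOrderStat _)]

lemma expInv_normOrderStatLaw_mono {r s : Fin K} (hrs : r ≤ s) :
    expInv (normOrderStatLaw M K r) ≤ expInv (normOrderStatLaw M K s) := by
  rw [expInv_normOrderStatLaw, expInv_normOrderStatLaw]
  refine lintegral_mono fun h => ENNReal.inv_le_inv.2 (ENNReal.ofReal_le_ofReal ?_)
  exact antitone_comp_descendingOrder (fun k => ‖h k‖ ^ 2) hrs

/-- Whichever user holds the rank, its reciprocal is at most the sum of all users' reciprocals. -/
lemma expInv_normOrderStatLaw_lt_top (hM : 1 < M) (r : Fin K) :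
    expInv (normOrderStatLaw M K r) < ∞ := by
  rw [expInv_normOrderStatLaw]
  have hk : ∀ k : Fin K, ∫⁻ h, (ENNReal.ofReal (‖h k‖ ^ 2))⁻¹
      ∂Measure.pi (fun _ : Fin K => complexGaussianVec M) = expInv (gammaMeasure M 1) := by
    intro k
    rw [expInv, ← map_norm_sq_complexGaussianVec (by omega), lintegral_map (by fun_prop)
      (by fun_prop)]
    exact (measurePreserving_eval (fun _ : Fin K => complexGaussianVec M) k).lintegral_comp
      (f := fun v => (ENNReal.ofReal (‖v‖ ^ 2))⁻¹) (by fun_prop)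
  calc _ ≤ ∫⁻ h, ∑ k, (ENNReal.ofReal (‖h k‖ ^ 2))⁻¹
        ∂Measure.pi (fun _ : Fin K => complexGaussianVec M) :=
        lintegral_mono fun h => Finset.single_le_sum
          (f := fun k => (ENNReal.ofReal (‖h k‖ ^ 2))⁻¹) (fun _ _ => zero_le)
          (Finset.mem_univ (descendingOrder (fun k => ‖h k‖ ^ 2) r))
    _ = ∑ k : Fin K, expInv (gammaMeasure M 1) := by
        rw [lintegral_finsetSum _ fun k _ => by fun_prop]
        simp_rw [hk]
    _ < ∞ := ENNReal.sum_lt_top.2 fun k _ =>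
        expInv_gammaMeasure_lt_top (by exact_mod_cast hM)

lemma expInv_sinSqLaw_lt_top {j : ℕ} (hj : j + 1 < M) : expInv (sinSqLaw M j) < ∞ := by
  unfold sinSqLaw
  split_ifs with h
  · rw [expInv, lintegral_dirac' _ (by fun_prop)]
    simp
  · refine expInv_betaMeasure_lt_top ?_ (by positivity)
    have : (j : ℝ) + 1 < M := by exact_mod_cast hj
    linarith

/-- Coupling: the same vector is measured against nested coordinate subspaces, and the larger one
makes the smaller angle. -/
lemma expInv_sinSqLaw_mono {i j : ℕ} (hij : i ≤ j) (hj : j < M) :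
    expInv (sinSqLaw M i) ≤ expInv (sinSqLaw M j) := by
  let b := EuclideanSpace.basisFun (Fin M) ℂ
  let S : ∀ i, i < M → Submodule ℂ (EuclideanSpace ℂ (Fin M)) :=
    fun i hi => Submodule.span ℂ (Set.range (b ∘ Fin.castLE hi.le))
  have hS : ∀ i hi, Module.finrank ℂ (S i hi) = i := fun i hi => by
    have : LinearIndependent ℂ (b ∘ Fin.castLE hi.le) :=
      b.orthonormal.linearIndependent.comp _ (Fin.castLE_injective _)
    rw [finrank_span_eq_card this, Fintype.card_fin]
  have hi := hij.trans_lt hj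
  have hle : S i hi ≤ S j hj := Submodule.span_mono (by
    rintro _ ⟨k, rfl⟩
    exact ⟨Fin.castLE hij k, rfl⟩)
  have e : ∀ i hi, expInv (sinSqLaw M i) = ∫⁻ v, (ENNReal.ofReal
      (Real.sin (subspaceAngle v (S i hi)) ^ 2))⁻¹ ∂complexGaussianVec M := fun i hi => by
    have := map_sin_sq (S i hi) ((hS i hi).trans_lt hi)
    rw [hS i hi] at this
    rw [expInv, ← this, lintegral_map (by fun_prop) (measurable_sin_sq_subspaceAngle _)]
  rw [e i hi, e j hj]
  refine lintegral_mono fun v => ENNReal.inv_le_inv.2 (ENNReal.ofReal_le_ofReal ?_)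
  rw [sin_sq_subspaceAngle, sin_sq_subspaceAngle]
  have h1 : ‖(S i hi).starProjection v‖ ≤ ‖(S j hj).starProjection v‖ := by
    have h2 := congrArg (fun T => T v) (Submodule.starProjection_comp_starProjection_of_le hle)
    simp only [ContinuousLinearMap.comp_apply] at h2
    rw [← h2]
    exact Submodule.norm_starProjection_apply_le _ _
  gcongr

/-- The rearrangement inequality in `[0, ∞]`. -/
lemma sum_mul_le_sum_comp_perm_mul_ennreal {n : ℕ} {a b : Fin n → ℝ≥0∞} (ha : Antitone a)
    (hb : Monotone b) (ha0 : ∀ i, a i ≠ 0) (hb0 : ∀ i, b i ≠ 0) (τ : Equiv.Perm (Fin n)) :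
    ∑ i, a i * b i ≤ ∑ i, a (τ i) * b i := by
  by_cases hbt : ∃ i, b i = ∞
  · obtain ⟨i, hi⟩ := hbt
    have : ∑ i, a (τ i) * b i = ∞ :=
      ENNReal.sum_eq_top.2 ⟨i, Finset.mem_univ _, by rw [hi, ENNReal.mul_top (ha0 _)]⟩
    rw [this]; exact le_top
  by_cases hat : ∃ i, a i = ∞
  · obtain ⟨i, hi⟩ := hat
    have : ∑ i, a (τ i) * b i = ∞ :=
      ENNReal.sum_eq_top.2 ⟨τ.symm i, Finset.mem_univ _, by
        rw [τ.apply_symm_apply, hi, ENNReal.top_mul (hb0 _)]⟩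
    rw [this]; exact le_top
  push Not at hbt hat
  have hanti : Antivary (fun i => (a i).toReal) fun i => (b i).toReal := by
    refine Antitone.antivary (fun i j hij => ENNReal.toReal_mono (hat _) (ha hij))
      fun i j hij => ENNReal.toReal_mono (hbt _) (hb hij)
  have h := hanti.sum_mul_le_sum_comp_perm_mul (σ := τ)
  rw [← ENNReal.toReal_le_toReal
    (ENNReal.sum_ne_top.2 fun i _ => ENNReal.mul_ne_top (hat _) (hbt _))
    (ENNReal.sum_ne_top.2 fun i _ => ENNReal.mul_ne_top (hat _) (hbt _)),
    ENNReal.toReal_sum fun i _ => ENNReal.mul_ne_top (hat _) (hbt _),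
    ENNReal.toReal_sum fun i _ => ENNReal.mul_ne_top (hat _) (hbt _)]
  simpa only [ENNReal.toReal_mul] using h

lemma nusSum_le_sum_perm (hKsM : Ks ≤ M) (hK : Ks ≤ K) (τ : Equiv.Perm (Fin Ks)) :
    nusSum M hK ≤ ∑ i, expInv (normOrderStatLaw M K (Fin.castLE hK (τ i).rev)) *
        expInv (sinSqAngleLaw M i) := by
  have hprob : ∀ r : Fin K, IsProbabilityMeasure (normOrderStatLaw M K r) := fun r =>
    Measure.isProbabilityMeasure_map (measurable_normOrderStat r).aemeasurable
  have hprob2 : ∀ i, IsProbabilityMeasure (sinSqAngleLaw M i) := fun i =>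
    Measure.isProbabilityMeasure_map (measurable_sinSqAngle _).aemeasurable
  refine sum_mul_le_sum_comp_perm_mul_ennreal
    (a := fun i : Fin Ks => expInv (normOrderStatLaw M K (Fin.castLE hK i.rev)))
    (fun i j hij => expInv_normOrderStatLaw_mono ?_) (fun i j hij => ?_)
    (fun i => expInv_pos _) (fun i => expInv_pos _) τ
  · exact Fin.rev_le_rev.2 hij
  · rw [sinSqAngleLaw_eq (i.2.trans_le hKsM), sinSqAngleLaw_eq (j.2.trans_le hKsM)]
    exact expInv_sinSqLaw_mono hij (j.2.trans_le hKsM)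

lemma nusSum_lt_top (hK : Ks ≤ K) (hKsM : Ks < M) : nusSum M hK < ∞ := by
  refine ENNReal.sum_lt_top.2 fun i _ => ENNReal.mul_lt_top ?_ ?_
  -- An index `i : Fin Ks` forces `1 ≤ Ks < M`, so the Gamma shape `M` exceeds `1`.
  · exact expInv_normOrderStatLaw_lt_top (by have := i.2; omega) _
  · have := i.2
    rw [sinSqAngleLaw_eq (by omega)]
    exact expInv_sinSqLaw_lt_top (by omega)

end

theorem mainTheorem2 {Ω : Type*} [MeasurableSpace Ω] (P : Measure Ω) [IsProbabilityMeasure P]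
    (M K Ks : ℕ) (hM : 0 < M) (hKsM : Ks ≤ M) (hK : Ks ≤ K) (σ : ℝ) (hσ : 0 < σ)
    (H : Fin K → Ω → EuclideanSpace ℂ (Fin M))
    (hindep : iIndepFun (fun (km : Fin K × Fin M) (ω : Ω) => H km.1 ω km.2) P)
    (hlaw : ∀ k m, HasLaw (fun ω => H k ω m) stdComplexGaussian P) :
    -- the average of the high-SINR minimum power, for every common SINR target
    (∀ γ : ℝ, 0 < γ →
      ∫⁻ ω, highSINRPower σ γ (nusChannels hK fun k => H k ω) ∂P =
        ENNReal.ofReal (σ ^ 2 * γ) * nusSum M hK) ∧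
    -- the average of the exact downlink minimum power, for large SINR targets
    Tendsto (fun γ : ℝ =>
        (∫⁻ ω, minPower (downlinkSINR σ (nusChannels hK fun k => H k ω)) γ ∂P) /
          ENNReal.ofReal γ)
      atTop (𝓝 (ENNReal.ofReal (σ ^ 2) * nusSum M hK)) ∧
    -- the same in the dual uplink
    Tendsto (fun γ : ℝ =>
        (∫⁻ ω, minPower (uplinkSINR σ (nusChannels hK fun k => H k ω)) γ ∂P) /
          ENNReal.ofReal γ)
      atTop (𝓝 (ENNReal.ofReal (σ ^ 2) * nusSum M hK)) ∧
    -- these averages are finite if there are more antennas than selected users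
    (Ks < M → nusSum M hK < ∞) ∧
    -- no other ordering of the selected users by norm rank has a smaller average
    (∀ (τ : Equiv.Perm (Fin Ks)) (γ : ℝ), 0 < γ →
      ∫⁻ ω, highSINRPower σ γ (nusChannels hK fun k => H k ω) ∂P ≤
        ∫⁻ ω, highSINRPower σ γ (fun i => nusChannels hK (fun k => H k ω) (τ i)) ∂P) ∧
    -- the distributions: norm order statistics and angles
    (∀ (r : Fin K) (x : ℝ),
      cdf (normOrderStatLaw M K r) x =
        ∑ j ∈ Finset.Icc (K - (r : ℕ)) K, (K.choose j : ℝ) *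
          cdf (gammaMeasure M 1) x ^ j * (1 - cdf (gammaMeasure M 1) x) ^ (K - j)) ∧
    sinSqAngleLaw M 0 = Measure.dirac 1 ∧
    (∀ j : ℕ, 0 < j → j < M → sinSqAngleLaw M j = betaMeasure ((M : ℝ) - j) j) := by
  have hX := hasLaw_channels hindep hlaw
  -- All orderings are handled at once; `τ = 1` is the weakest-to-strongest one.
  have hmeas : ∀ (γ : ℝ) (τ : Equiv.Perm (Fin Ks)),
      ∫⁻ ω, highSINRPower σ γ (fun i => nusChannels hK (fun k => H k ω) (τ i)) ∂P =
        ENNReal.ofReal (σ ^ 2 * γ) *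
          ∑ i, expInv (normOrderStatLaw M K (Fin.castLE hK (τ i).rev)) *
            expInv (sinSqAngleLaw M i) := by
    intro γ τ
    have hm : Measurable fun (h : Fin K → EuclideanSpace ℂ (Fin M)) i => nusChannels hK h (τ i) :=
      measurable_pi_lambda _ fun i => measurable_pi_iff.1 (measurable_nusChannels hK) (τ i)
    rw [← lintegral_highSINRPower hKsM hK σ γ τ, ← hX.lintegral_comp
      (f := fun h => highSINRPower σ γ (fun i => nusChannels hK h (τ i)))
      ((measurable_highSINRPower σ γ).comp hm).aemeasurable]
  refine ⟨fun γ _ => hmeas γ 1, ?_, ?_, nusSum_lt_top hK, fun τ γ _ => ?_,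
    cdf_normOrderStatLaw hM, ?_, fun j hj0 hjM => ?_⟩
  · exact tendsto_lintegral_div hKsM hK hσ hX
      (q := fun g γ => minPower (downlinkSINR σ g) γ)
      (fun g γ hγ => le_minPower_downlink hσ hγ g) fun g γ hγ => minPower_downlink_le hσ hγ g
  · exact tendsto_lintegral_div hKsM hK hσ hX
      (q := fun g γ => minPower (uplinkSINR σ g) γ)
      (fun g γ hγ => le_minPower_uplink hσ hγ g) fun g γ hγ => minPower_uplink_le hσ hγ g
  · rw [hmeas γ τ]
    refine (hmeas γ 1).trans_le (mul_le_mul_right ?_ _)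
    exact nusSum_le_sum_perm hKsM hK τ
  · rw [sinSqAngleLaw_eq hM, sinSqLaw, if_pos rfl]
  · rw [sinSqAngleLaw_eq hjM, sinSqLaw, if_neg hj0.ne']
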